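/- Let $r$ be a natural number and let $\Gamma$ be a graph without loops; multiple edges are allowed. If $r$ is odd, suppose that each edge of $\Gamma$ is oriented, i.e. its two end vertices are ordered. For a graph $G$ (possibly with loops, with orientations if $r$ is odd) let $\Lambda^r(G)$ be the graded ring generated over $\mathbb Z$ by one generator $e_\beta$ of degree $r-1$ for each edge $\beta$ of $G$, with the relations $e_\beta^2=0$ and $e_\beta e_\gamma=(-1)^{r-1}e_\gamma e_\beta$; so it is the exterior algebra on the edges if $r$ is even, and the commutative polynomial ring on the edges modulo the squares of the generators if $r$ is odd. A circuit $w$ in $G$ consists of edges $w_1,\dots,w_l$ ($l\ge 1$) and vertices $v_1,\dots,v_l,v_{l+1}=v_1$ such that $v_i,v_{i+1}$ are the two ends of $w_i$. Its Arnold class is \[ A(w)=\sum_{i=1}^l(-1)^i e_{w_1}\cdots\widehat{e_{w_i}}\cdots e_{w_l}\ (r\text{ even}),\qquad A(w)=\sum_{i=1}^l\epsilon_i(w)\, e_{w_1}\cdots\widehat{e_{w_i}}\cdots e_{w_l}\ (r\text{ odd}), \] where $\epsilon_i(w)=1$ if $v_i$ is the first vertex of $w_i$ in its orientation and $\epsilon_i(w)=-1$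 otherwise; for a circuit that consists of a single loop, $A(w)=1$. Let $I^r(G)$ be the ideal of $\Lambda^r(G)$ generated by all $A(w)$, let $R^r(G)=\Lambda^r(G)/I^r(G)$, and let $R^r(G)_k$ be its part of degree $k$. For an edge $\alpha$ of $\Gamma$ let $\Gamma\smallsetminus\alpha$ be the graph obtained by deleting $\alpha$, and $\Gamma/\alpha$ the graph obtained from it by identifying the two ends of $\alpha$ (all edges other than $\alpha$ are kept, so edges parallel to $\alpha$ become loops), with the induced orientations. Write $[\beta]$ for the edge of $\Gamma/\alpha$ given by an edge $\beta\ne\alpha$. Then for every edge $\alpha$ of $\Gamma$ there are ring homomorphisms $i_\alpha:R^r(\Gamma\smallsetminus\alpha)\to R^r(\Gamma)$, $e_\beta\mapsto e_\beta$, and $q_\alpha:R^r(\Gamma\smallsetminus\alpha)\to R^r(\Gamma/\alpha)$, $e_\beta\mapsto e_{[\beta]}$, and a homomorphism of abelian groups $g_\alpha:R^r(\Gamma)\to R^r(\Gamma/\alpha)$ with $g_\alpha\big(i_\alpha(x)+i_\alpha(y)e_\alpha\big)=q_\alpha(y)$ for all $x,y\in R^r(\Gamma\smallsetminus\alpha)$,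 and for every integer $k$ the maps $i_\alpha$ and $g_\alpha$ restrict to a short exact sequence of abelian groups \[ 0\to R^r(\Gamma\smallsetminus\alpha)_k\xrightarrow{\,i_\alpha\,} R^r(\Gamma)_k\xrightarrow{\,g_\alpha\,} R^r(\Gamma/\alpha)_{k-r+1}\to 0 . \] -/

import Mathlib

open scoped Graph

noncomputable section

namespace GraphRing

universe u v

/-- The defining relations of the free (strictly) graded commutative `ℤ`-algebra on generators
`e` of degree `r - 1` indexed by `X`, with squares of the generators equal to zero. As `r - 1` and
`r + 1` have the same parity, two generators anticommute for `r` even and commute for `r` odd. -/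
inductive Rel (r : ℕ) (X : Type v) : FreeAlgebra ℤ X → FreeAlgebra ℤ X → Prop
  | sq (a : X) : Rel r X (FreeAlgebra.ι ℤ a * FreeAlgebra.ι ℤ a) 0
  | comm (a b : X) : Rel r X (FreeAlgebra.ι ℤ a * FreeAlgebra.ι ℤ b)
      ((-1) ^ (r + 1) * (FreeAlgebra.ι ℤ b * FreeAlgebra.ι ℤ a))

/-- The algebra `Λ^r` on a set `X` of generators: the exterior algebra over `ℤ` if `r` is even,
the commutative polynomial ring modulo the squares of the generators if `r` is odd. -/
abbrev Lam (r : ℕ) (X : Type v) : Type v := RingQuot (Rel r X)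

/-- The generator `e_a` of `Λ^r`. -/
def Lam.gen (r : ℕ) {X : Type v} (a : X) : Lam r X :=
  RingQuot.mkRingHom (Rel r X) (FreeAlgebra.ι ℤ a)

/-- The product `e_{a₁} ⋯ e_{aₘ}` in `Λ^r` of a list of generators. -/
def Lam.mon (r : ℕ) {X : Type v} (l : List X) : Lam r X := (l.map (Lam.gen r)).prod

/-- The part of `Λ^r` of degree `k`: the span of the products of `m` generators, `m (r - 1) = k`. -/
def Lam.deg (r : ℕ) (X : Type v) (k : ℤ) : AddSubgroup (Lam r X) :=
  AddSubgroup.closure {x | ∃ l : List X, (l.length : ℤ) * ((r : ℤ) - 1) = k ∧ x = Lam.mon r l}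

variable {V : Type u} {E : Type v}

/-- A circuit: edges `w₁, …, wₗ`, `l ≥ 1`, and vertices `v₁, …, vₗ, vₗ₊₁ = v₁` such that `vᵢ` and
`vᵢ₊₁` are the two ends of `wᵢ` (here numbered from `0`; the values of `v` beyond `l` play no
role). -/
structure IsCircuit (Γ : Graph V E) (w : List E(Γ)) (v : ℕ → V) : Prop where
  ne_nil : w ≠ []
  link : ∀ (i : ℕ) (h : i < w.length), Γ.IsLink (w[i] : E) (v i) (v (i + 1))
  closed : v w.length = v 0

/-- An orientation of the edges of `Γ`, given by the first vertex `o e` of each edge `e`. -/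
def IsOrientation (Γ : Graph V E) (o : E → V) : Prop := ∀ e ∈ E(Γ), Γ.Inc e (o e)

open Classical in
/-- The sign of the `i`-th summand of the Arnold class: `(-1)^i` for `r` even, and for `r` odd
`1` or `-1` according to whether the circuit runs through its `i`-th edge along the orientation or
against it. -/
def arnoldSign (r : ℕ) {Γ : Graph V E} (o : E → V) (w : List E(Γ)) (v : ℕ → V)
    (i : Fin w.length) : Lam r E(Γ) :=
  if Even r then (-1) ^ (i : ℕ) else if o (w[i] : E) = v i then 1 else -1

/-- The Arnold class `A(w) = ∑ᵢ ± w₁ ⋯ ŵᵢ ⋯ wₗ` of a circuit. For a loop it is `1`. (Numbering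
the edges from `0` changes it for `r` even at most by an overall sign.) -/
def arnold (r : ℕ) {Γ : Graph V E} (o : E → V) (w : List E(Γ)) (v : ℕ → V) : Lam r E(Γ) :=
  ∑ i : Fin w.length, arnoldSign r o w v i * Lam.mon r (w.eraseIdx i)

/-- The generalized Arnold ideal `I^r(Γ)`. -/
def arnoldIdeal (r : ℕ) (Γ : Graph V E) (o : E → V) : TwoSidedIdeal (Lam r E(Γ)) :=
  TwoSidedIdeal.span {x | ∃ (w : List E(Γ)) (v : ℕ → V), IsCircuit Γ w v ∧ x = arnold r o w v}

/-- The ring `R^r(Γ) = Λ^r(Γ) / I^r(Γ)`. For `r` even it does not depend on `o`. -/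
abbrev R (r : ℕ) (Γ : Graph V E) (o : E → V) : Type v := (arnoldIdeal r Γ o).ringCon.Quotient

/-- The class of the generator `e_a` in `R^r(Γ)`. -/
def gen (r : ℕ) (Γ : Graph V E) (o : E → V) (a : E(Γ)) : R r Γ o :=
  (arnoldIdeal r Γ o).ringCon.mk' (Lam.gen r a)

/-- The part `R^r(Γ)_k` of degree `k`: the image of the part of `Λ^r(Γ)` of degree `k`. -/
def deg (r : ℕ) (Γ : Graph V E) (o : E → V) (k : ℤ) : AddSubgroup (R r Γ o) :=
  (Lam.deg r E(Γ) k).map ((arnoldIdeal r Γ o).ringCon.mk' : Lam r E(Γ) →+ R r Γ o)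

/-- The graph `Γ ∖ α`. -/
abbrev del (Γ : Graph V E) (α : E) : Graph V E := Γ.deleteEdges {α}

/-- The vertices after contraction of `α`: the two ends of `α` are identified. -/
abbrev ContrV (Γ : Graph V E) (α : E) : Type u := Quot (Γ.IsLink α)

/-- The graph `Γ / α`: delete `α` and identify its two ends. All other edges are kept, so that
edges parallel to `α` become loops. -/
abbrev contr (Γ : Graph V E) (α : E) : Graph (ContrV Γ α) E :=
  (del Γ α).map (Quot.mk (Γ.IsLink α))

/-- The orientation of `Γ / α` induced by an orientation of `Γ`. -/
def contrOr (Γ : Graph V E) (α : E) (o : E → V) : E → ContrV Γ α := fun e => Quot.mk _ (o e)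

/-- An edge of `Γ ∖ α` as an edge of `Γ`. -/
def delEdge {Γ : Graph V E} {α : E} (b : E(del Γ α)) : E(Γ) := ⟨b, b.2.1⟩

/-- An edge of `Γ ∖ α` as an edge of `Γ / α`. -/
def contrEdge {Γ : Graph V E} {α : E} (b : E(del Γ α)) : E(contr Γ α) := ⟨b, b.2⟩

end GraphRing

end

/-! An element of `Λ(Γ)` is uniquely `u + v e_α` with `e_α` occurring neither in `u` nor in `v`, and
`g_α` is induced by `u + v e_α ↦ v`. It is well defined because moving `e_α` to the right turns the
Arnold class of a closed walk in `Γ` into an element of the ideal generated by the Arnold class and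
the product of the closed walk induced in `Γ / α`. Conversely, a closed walk in `Γ / α` is composed
of walks in `Γ ∖ α` that are closed or closed up by `α`; hence, if `v` lies in the ideal of `Γ / α`,
then modulo the ideal of `Γ` the element `v e_α` is congruent to one without `e_α`, which is
exactness in the middle.

For the injectivity of `i_α` one shows that an element `x` of the ideal of `Γ` in which only edges
from a finite set `T` occur lies in the ideal of `T`, by induction on `T`. If `α ∈ T`, edges outside
`T` parallel to `α` may be replaced by `α`. Then the coefficient of `e_α` in `x` lies in the ideal
of `T / α`: by induction in `Γ / α`, or trivially if `T / α` has a loop. So `x` is congruent modulo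
the ideal of `T` to an element supported on `T ∖ α`, to which the induction hypothesis for `Γ`
applies. -/

noncomputable section

namespace GraphRing

set_option maxSynthPendingDepth 3

section Algebra

variable {r : ℕ} {X Y B : Type*} [Ring B]

/-- The sign `(-1)^(r-1)` that two generators acquire when they are interchanged. The exponent is
written `r + 1` to avoid truncated subtraction. -/
def commSign (r : ℕ) : ℤ := (-1) ^ (r + 1)

theorem commSign_mul_self (r : ℕ) : commSign r * commSign r = 1 := by
  rw [commSign, ← mul_pow]
  simp

theorem Lam.gen_mul_self (a : X) : Lam.gen r a * Lam.gen r a = 0 := by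
  rw [Lam.gen, ← map_mul, RingQuot.mkRingHom_rel (Rel.sq a), map_zero]

theorem Lam.gen_mul_gen (a b : X) :
    Lam.gen r a * Lam.gen r b = commSign r • (Lam.gen r b * Lam.gen r a) := by
  rw [Lam.gen, Lam.gen, ← map_mul, RingQuot.mkRingHom_rel (Rel.comm a b), zsmul_eq_mul]
  simp [commSign]

/-- The universal property of `Λ^r`. -/
def Lam.lift (f : X → B) (hsq : ∀ a, f a * f a = 0)
    (hcomm : ∀ a b, f a * f b = commSign r • (f b * f a)) : Lam r X →+* B :=
  RingQuot.lift ⟨(FreeAlgebra.lift ℤ f : FreeAlgebra ℤ X →+* B), by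
    rintro _ _ (⟨a⟩ | ⟨a, b⟩)
    · simp [hsq]
    · simp [hcomm a b, commSign]⟩

@[simp] theorem Lam.lift_gen (f : X → B) (hsq : ∀ a, f a * f a = 0)
    (hcomm : ∀ a b, f a * f b = commSign r • (f b * f a)) (a : X) :
    Lam.lift f hsq hcomm (Lam.gen r a) = f a := by
  simp [Lam.lift, Lam.gen]

@[elab_as_elim]
theorem Lam.induction {p : Lam r X → Prop} (intCast : ∀ n : ℤ, p n) (gen : ∀ a, p (Lam.gen r a))
    (add : ∀ x y, p x → p y → p (x + y)) (mul : ∀ x y, p x → p y → p (x * y)) (x : Lam r X) :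
    p x := by
  obtain ⟨y, rfl⟩ := RingQuot.mkRingHom_surjective (Rel r X) x
  induction y using FreeAlgebra.induction with
  | grade0 n => simpa using intCast n
  | grade1 a => exact gen a
  | mul x y hx hy => simpa only [map_mul] using mul _ _ hx hy
  | add x y hx hy => simpa only [map_add] using add _ _ hx hy

theorem Lam.hom_ext {f g : Lam r X →+* B} (h : ∀ a, f (Lam.gen r a) = g (Lam.gen r a)) :
    f = g := RingHom.ext fun x => by
  induction x using Lam.induction with
  | intCast n => simp
  | gen a => exact h a
  | add x y hx hy => simp only [map_add, hx, hy]
  | mul x y hx hy => simp only [map_mul, hx, hy]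

open Classical in
/-- The endomorphism of `Λ^r` that kills the generators outside `S` and fixes the others. -/
def Lam.ret (S : Set X) : Lam r X →+* Lam r X :=
  Lam.lift (S.indicator (Lam.gen r))
    (fun a => by by_cases h : a ∈ S <;> simp [h, Lam.gen_mul_self])
    (fun a b => by
      by_cases h : a ∈ S <;> by_cases h' : b ∈ S <;> simp [h, h', Lam.gen_mul_gen a b])

theorem Lam.ret_gen (S : Set X) (a : X) :
    Lam.ret S (Lam.gen r a) = S.indicator (Lam.gen r) a := by simp [Lam.ret]

@[simp] theorem Lam.ret_gen_of_mem {S : Set X} {a : X} (h : a ∈ S) :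
    Lam.ret S (Lam.gen r a) = Lam.gen r a := by simp [Lam.ret_gen, h]

@[simp] theorem Lam.ret_gen_of_notMem {S : Set X} {a : X} (h : a ∉ S) :
    Lam.ret S (Lam.gen r a) = 0 := by simp [Lam.ret_gen, h]

theorem Lam.ret_ret (S T : Set X) (x : Lam r X) :
    Lam.ret S (Lam.ret T x) = Lam.ret (S ∩ T) x := by
  have : (Lam.ret S).comp (Lam.ret T) = Lam.ret (r := r) (S ∩ T) :=
    Lam.hom_ext fun a => by by_cases h : a ∈ S <;> by_cases h' : a ∈ T <;> simp [h, h']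
  exact congr($this x)

/-- The subring of `Λ^r` generated by the generators in `S`, encoded as the set of fixed points of
the retraction `Lam.ret S`. -/
def Lam.supported (r : ℕ) (S : Set X) : Subring (Lam r X) :=
  (Lam.ret S).eqLocus (RingHom.id _)

theorem Lam.mem_supported {S : Set X} {x : Lam r X} :
    x ∈ Lam.supported r S ↔ Lam.ret S x = x := Iff.rfl

theorem Lam.gen_mem_supported {S : Set X} {a : X} (h : a ∈ S) :
    Lam.gen r a ∈ Lam.supported r S := Lam.ret_gen_of_mem h

theorem Lam.ret_mem_supported {S T : Set X} {x : Lam r X} (hx : x ∈ Lam.supported r T) :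
    Lam.ret S x ∈ Lam.supported r (S ∩ T) := by
  rw [Lam.mem_supported, Lam.ret_ret, Set.inter_right_comm, Set.inter_self, ← Lam.ret_ret,
    Lam.mem_supported.1 hx]

theorem Lam.supported_mono {S T : Set X} (h : S ⊆ T) :
    Lam.supported r S ≤ Lam.supported r T := fun x hx => by
  rw [Lam.mem_supported, ← Lam.mem_supported.1 hx, Lam.ret_ret, Set.inter_eq_right.2 h]

theorem Lam.mem_supported_univ (x : Lam r X) : x ∈ Lam.supported r Set.univ := by
  have : Lam.ret Set.univ = RingHom.id (Lam r X) := Lam.hom_ext fun a => by simp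
  exact congr($this x)

theorem Lam.exists_finset_mem_supported (x : Lam r X) :
    ∃ F : Finset X, x ∈ Lam.supported r (F : Set X) := by
  classical
  induction x using Lam.induction with
  | intCast n => exact ⟨∅, intCast_mem _ n⟩
  | gen a => exact ⟨{a}, Lam.gen_mem_supported (by simp)⟩
  | add x y hx hy =>
    obtain ⟨⟨F, hF⟩, ⟨G, hG⟩⟩ := And.intro hx hy
    exact ⟨F ∪ G, add_mem (Lam.supported_mono (by simp) hF) (Lam.supported_mono (by simp) hG)⟩
  | mul x y hx hy =>
    obtain ⟨⟨F, hF⟩, ⟨G, hG⟩⟩ := And.intro hx hy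
    exact ⟨F ∪ G, mul_mem (Lam.supported_mono (by simp) hF) (Lam.supported_mono (by simp) hG)⟩

/-- The automorphism of `Λ^r` that multiplies each generator by the commutation sign; it describes
moving a generator past an element. -/
def Lam.twist : Lam r X →+* Lam r X :=
  Lam.lift (fun a => commSign r • Lam.gen r a)
    (fun a => by rw [smul_mul_smul_comm, Lam.gen_mul_self, smul_zero])
    (fun a b => by rw [smul_mul_smul_comm, smul_mul_smul_comm, Lam.gen_mul_gen, smul_comm])

@[simp] theorem Lam.twist_gen (a : X) :
    Lam.twist (Lam.gen r a) = commSign r • Lam.gen r a := by simp [Lam.twist]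

theorem Lam.twist_twist (x : Lam r X) : Lam.twist (Lam.twist x) = x := by
  have : Lam.twist.comp Lam.twist = RingHom.id (Lam r X) := Lam.hom_ext fun a => by
    simp [-zsmul_eq_mul, smul_smul, commSign_mul_self]
  exact congr($this x)

theorem Lam.twist_ret (S : Set X) (x : Lam r X) :
    Lam.twist (Lam.ret S x) = Lam.ret S (Lam.twist x) := by
  have : Lam.twist.comp (Lam.ret S) = (Lam.ret (r := r) S).comp Lam.twist :=
    Lam.hom_ext fun a => by by_cases h : a ∈ S <;> simp [h]
  exact congr($this x)

theorem Lam.twist_mem_supported {S : Set X} {x : Lam r X} (hx : x ∈ Lam.supported r S) :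
    Lam.twist x ∈ Lam.supported r S := by
  rw [Lam.mem_supported, ← Lam.twist_ret, Lam.mem_supported.1 hx]

theorem Lam.gen_mul (a : X) (x : Lam r X) : Lam.gen r a * x = Lam.twist x * Lam.gen r a := by
  induction x using Lam.induction with
  | intCast n => rw [map_intCast, (Int.cast_commute n _).eq]
  | gen b => rw [Lam.twist_gen, smul_mul_assoc, Lam.gen_mul_gen]
  | add x y hx hy => rw [mul_add, hx, hy, map_add, add_mul]
  | mul x y hx hy => rw [← mul_assoc, hx, mul_assoc, hy, map_mul, mul_assoc]

end Algebra

section Coefficient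

variable {r : ℕ} {X : Type*}

open Classical in
/-- The representation of `Λ^r` by upper triangular matrices whose upper right entry is the
coefficient of `e_a`; see `Lam.coeffMatrix_eq`. -/
def Lam.coeffMatrix (a : X) : Lam r X →+* Matrix (Fin 2) (Fin 2) (Lam r X) :=
  Lam.lift (fun b => if b = a then !![0, 1; 0, 0] else
      !![Lam.gen r b, 0; 0, commSign r • Lam.gen r b])
    (fun b => by
      split_ifs <;> ext i j <;> fin_cases i <;> fin_cases j <;>
        simp [-zsmul_eq_mul, mul_smul_comm, Lam.gen_mul_self])
    (fun b d => by
      split_ifs <;> ext i j <;> fin_cases i <;> fin_cases j <;>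
        simp [-zsmul_eq_mul, mul_smul_comm, smul_smul, commSign_mul_self, Lam.gen_mul_gen b d])

theorem Lam.coeffMatrix_gen_self (a : X) :
    Lam.coeffMatrix a (Lam.gen r a) = !![0, 1; 0, 0] := by simp [Lam.coeffMatrix]

theorem Lam.coeffMatrix_gen_of_ne {a b : X} (h : b ≠ a) :
    Lam.coeffMatrix a (Lam.gen r b) = !![Lam.gen r b, 0; 0, Lam.twist (Lam.gen r b)] := by
  simp [Lam.coeffMatrix, h]

/-- The coefficient `v` of `e_a` in an element `u + v e_a`, where `e_a` does not occur in `u`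
and `v`. -/
def Lam.coeff (a : X) : Lam r X →+ Lam r X :=
  (Matrix.entryAddMonoidHom _ 0 1).comp (Lam.coeffMatrix a).toAddMonoidHom

theorem Lam.coeffMatrix_eq (a : X) (x : Lam r X) : Lam.coeffMatrix a x =
    !![Lam.ret {a}ᶜ x, Lam.coeff a x; 0, Lam.twist (Lam.ret {a}ᶜ x)] := by
  induction x using Lam.induction with
  | intCast n =>
    ext i j
    fin_cases i <;> fin_cases j <;> simp [Lam.coeff, Matrix.intCast_apply]
  | gen b =>
    rcases eq_or_ne b a with rfl | h
    · simp [Lam.coeff, Lam.coeffMatrix_gen_self]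
    · simp [Lam.coeff, Lam.coeffMatrix_gen_of_ne h, h]
  | add x y hx hy => simp [map_add, hx, hy]
  | mul x y hx hy =>
    have hxy : Lam.coeff a (x * y) = (Lam.coeffMatrix a x * Lam.coeffMatrix a y) 0 1 :=
      congr($(map_mul (Lam.coeffMatrix a) x y) 0 1)
    ext i j
    fin_cases i <;> fin_cases j <;> simp [hxy, hx, hy]

theorem Lam.coeff_mul (a : X) (x y : Lam r X) : Lam.coeff a (x * y) =
    Lam.ret {a}ᶜ x * Lam.coeff a y + Lam.coeff a x * Lam.twist (Lam.ret {a}ᶜ y) := by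
  have := congr($(map_mul (Lam.coeffMatrix a) x y) 0 1)
  simpa [Lam.coeffMatrix_eq, Matrix.mul_apply] using this

@[simp] theorem Lam.coeff_gen_self (a : X) : Lam.coeff a (Lam.gen r a) = 1 := by
  simp [Lam.coeff, Lam.coeffMatrix_gen_self]

theorem Lam.coeff_eq_zero {a : X} {x : Lam r X} (h : x ∈ Lam.supported r {a}ᶜ) :
    Lam.coeff a x = 0 := by
  rw [← Lam.mem_supported.1 h]
  clear h
  induction x using Lam.induction with
  | intCast n => simp [Lam.coeff, Matrix.intCast_apply]
  | gen b =>
    rcases eq_or_ne b a with rfl | h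
    · simp
    · simp [Lam.coeff, Lam.coeffMatrix_gen_of_ne h, h]
  | add x y hx hy => simp [hx, hy]
  | mul x y hx hy => simp [Lam.coeff_mul, hx, hy]

theorem Lam.coeff_add_mul_gen {a : X} {u v : Lam r X} (hu : u ∈ Lam.supported r {a}ᶜ)
    (hv : v ∈ Lam.supported r {a}ᶜ) : Lam.coeff a (u + v * Lam.gen r a) = v := by
  simp [Lam.coeff_mul, Lam.coeff_eq_zero hu, Lam.coeff_eq_zero hv, Lam.mem_supported.1 hv]

theorem Lam.exists_eq_add_mul_gen {S : Set X} (a : X) {x : Lam r X}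
    (hx : x ∈ Lam.supported r S) : ∃ u ∈ Lam.supported r (S \ {a}),
      ∃ v ∈ Lam.supported r (S \ {a}), x = u + v * Lam.gen r a := by
  rw [← Lam.mem_supported.1 hx]
  clear hx
  induction x using Lam.induction with
  | intCast n => exact ⟨n, intCast_mem _ n, 0, zero_mem _, by simp⟩
  | gen b =>
    by_cases hb : b ∈ S
    · rcases eq_or_ne b a with rfl | h
      · exact ⟨0, zero_mem _, 1, one_mem _, by simp [hb]⟩
      · exact ⟨_, Lam.gen_mem_supported ⟨hb, h⟩, 0, zero_mem _, by simp [hb]⟩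
    · exact ⟨0, zero_mem _, 0, zero_mem _, by simp [hb]⟩
  | add x y hx hy =>
    obtain ⟨u, hu, v, hv, hx⟩ := hx
    obtain ⟨u', hu', v', hv', hy⟩ := hy
    exact ⟨u + u', add_mem hu hu', v + v', add_mem hv hv', by rw [map_add, hx, hy]; noncomm_ring⟩
  | mul x y hx hy =>
    obtain ⟨u, hu, v, hv, hx⟩ := hx
    obtain ⟨u', hu', v', hv', hy⟩ := hy
    refine ⟨u * u', mul_mem hu hu', u * v' + v * Lam.twist u', add_mem (mul_mem hu hv')
      (mul_mem hv (Lam.twist_mem_supported hu')), ?_⟩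
    calc Lam.ret S (x * y)
        = u * u' + u * v' * Lam.gen r a + v * (Lam.gen r a * u') +
            v * (Lam.gen r a * v') * Lam.gen r a := by rw [map_mul, hx, hy]; noncomm_ring
      _ = u * u' + (u * v' + v * Lam.twist u') * Lam.gen r a +
            v * Lam.twist v' * (Lam.gen r a * Lam.gen r a) := by
          rw [Lam.gen_mul, Lam.gen_mul]; noncomm_ring
      _ = _ := by rw [Lam.gen_mul_self, mul_zero, add_zero]

theorem Lam.coeff_mem_supported {S : Set X} {a : X} {x : Lam r X}
    (hx : x ∈ Lam.supported r S) : Lam.coeff a x ∈ Lam.supported r (S \ {a}) := by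
  obtain ⟨u, hu, v, hv, rfl⟩ := Lam.exists_eq_add_mul_gen a hx
  have hle : Lam.supported r (S \ {a}) ≤ Lam.supported r {a}ᶜ :=
    Lam.supported_mono fun _ h => h.2
  rwa [Lam.coeff_add_mul_gen (hle hu) (hle hv)]

theorem Lam.eq_ret_add_coeff_mul_gen (a : X) (x : Lam r X) :
    x = Lam.ret {a}ᶜ x + Lam.coeff a x * Lam.gen r a := by
  obtain ⟨u, hu, v, hv, rfl⟩ := Lam.exists_eq_add_mul_gen a (Lam.mem_supported_univ x)
  rw [← Set.compl_eq_univ_sdiff] at hu hv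
  rw [Lam.coeff_add_mul_gen hu hv]
  simp [Lam.mem_supported.1 hu]

end Coefficient

section ArnoldSum

variable {B C : Type*} [Ring B] [Ring C]

/-- The signed sum `∑ᵢ ε^i a₁ ⋯ âᵢ ⋯ aₗ`, `ε = (-1)^(r-1)`, of the products of all but one of the
members of a list. -/
def arnoldSum (r : ℕ) : List B → B
  | [] => 0
  | a :: L => L.prod + commSign r • (a * arnoldSum r L)

theorem map_arnoldSum (r : ℕ) (f : B →+* C) (L : List B) :
    f (arnoldSum r L) = arnoldSum r (L.map f) := by
  induction L with
  | nil => exact map_zero f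
  | cons a L ih => simp only [arnoldSum, List.map_cons, map_add, map_zsmul, map_mul, ih,
      map_list_prod]

theorem arnoldSum_append (r : ℕ) (L M : List B) : arnoldSum r (L ++ M) =
    arnoldSum r L * M.prod + commSign r ^ L.length • (L.prod * arnoldSum r M) := by
  induction L with
  | nil => simp [arnoldSum]
  | cons a L ih =>
    simp only [List.cons_append, arnoldSum, ih, List.prod_append, List.length_cons,
      List.prod_cons, mul_add, add_mul, smul_add, mul_smul_comm, smul_mul_assoc, smul_smul,
      pow_succ', mul_assoc, add_assoc]

end ArnoldSum

section Dart

variable {r : ℕ} {X V : Type*}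

/-- An edge together with a direction in which it is traversed; `true` is the direction from the
first to the second end. -/
abbrev Dart (X : Type*) := X × Bool

/-- The vertex at which a dart starts, the ends of the edge `b` being `s b` and `t b`. -/
def Dart.tail (s t : X → V) (d : Dart X) : V := if d.2 then s d.1 else t d.1

/-- The vertex at which a dart ends. -/
def Dart.head (s t : X → V) (d : Dart X) : V := if d.2 then t d.1 else s d.1

/-- The same edge traversed in the other direction. -/
def Dart.rev (d : Dart X) : Dart X := (d.1, !d.2)

theorem Dart.tail_rev (s t : X → V) (d : Dart X) : d.rev.tail s t = d.head s t := by
  obtain ⟨b, _ | _⟩ := d <;> rfl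

theorem Dart.head_rev (s t : X → V) (d : Dart X) : d.rev.head s t = d.tail s t := by
  obtain ⟨b, _ | _⟩ := d <;> rfl

/-- The sign of a dart: for `r` odd, traversing an edge backwards changes the sign of its
generator. -/
def Dart.sign (r : ℕ) (d : Dart X) : ℤ := if d.2 then 1 else -commSign r

theorem Dart.sign_mul_self (d : Dart X) : d.sign r * d.sign r = 1 := by
  unfold Dart.sign
  split_ifs <;> simp [commSign_mul_self]

theorem Dart.sign_rev (d : Dart X) : d.rev.sign r = -commSign r * d.sign r := by
  obtain ⟨b, _ | _⟩ := d <;> simp [Dart.rev, Dart.sign, commSign_mul_self]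

/-- The generator of an edge with the sign of the direction. With these signs the Arnold class of
a circuit is, up to an overall sign, an `arnoldSum`. -/
def Dart.weight (r : ℕ) (d : Dart X) : Lam r X := d.sign r • Lam.gen r d.1

@[simp] theorem Dart.weight_mk_true (b : X) : Dart.weight r (b, true) = Lam.gen r b := by
  simp [Dart.weight, Dart.sign]

theorem Dart.weight_rev (d : Dart X) : d.rev.weight r = -commSign r • d.weight r := by
  rw [Dart.weight, Dart.weight, smul_smul, Dart.sign_rev, Dart.rev]

theorem Dart.sign_smul_weight (d : Dart X) : d.sign r • d.weight r = Lam.gen r d.1 := by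
  rw [Dart.weight, smul_smul, Dart.sign_mul_self, one_smul]

theorem Dart.weight_mul_weight {d e : Dart X} (h : d.1 = e.1) :
    d.weight r * e.weight r = 0 := by
  rw [Dart.weight, Dart.weight, h, smul_mul_smul_comm, Lam.gen_mul_self, smul_zero]

theorem Dart.weight_mul (d : Dart X) (x : Lam r X) :
    d.weight r * x = Lam.twist x * d.weight r := by
  rw [Dart.weight, smul_mul_assoc, Lam.gen_mul, mul_smul_comm]

theorem Dart.twist_weight (d : Dart X) :
    Lam.twist (d.weight r) = commSign r • d.weight r := by
  rw [Dart.weight, map_zsmul, Lam.twist_gen, smul_comm]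

theorem Dart.weight_mem_supported {d : Dart X} {S : Set X} (h : d.1 ∈ S) :
    d.weight r ∈ Lam.supported r S := zsmul_mem (Lam.gen_mem_supported h) _

/-- The product of the weights of a list of darts. -/
def dartProd (r : ℕ) (L : List (Dart X)) : Lam r X := (L.map (Dart.weight r)).prod

/-- The Arnold class of a list of darts. -/
def dartSum (r : ℕ) (L : List (Dart X)) : Lam r X := arnoldSum r (L.map (Dart.weight r))

@[simp] theorem dartProd_nil : dartProd r ([] : List (Dart X)) = 1 := rfl

@[simp] theorem dartProd_cons (d : Dart X) (L : List (Dart X)) :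
    dartProd r (d :: L) = d.weight r * dartProd r L := rfl

@[simp] theorem dartSum_nil : dartSum r ([] : List (Dart X)) = 0 := rfl

theorem dartSum_cons (d : Dart X) (L : List (Dart X)) :
    dartSum r (d :: L) = dartProd r L + commSign r • (d.weight r * dartSum r L) := rfl

theorem dartSum_append (L M : List (Dart X)) : dartSum r (L ++ M) =
    dartSum r L * dartProd r M + commSign r ^ L.length • (dartProd r L * dartSum r M) := by
  simp only [dartSum, List.map_append, arnoldSum_append, List.length_map, dartProd]

theorem dartSum_singleton (d : Dart X) : dartSum r [d] = 1 := by simp [dartSum_cons]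

theorem dartSum_cons_rev_cons (d : Dart X) (L : List (Dart X)) :
    dartSum r (d :: d.rev :: L) = 0 := by
  have hprod : d.weight r * d.rev.weight r = 0 := Dart.weight_mul_weight rfl
  rw [dartSum_cons, dartSum_cons, dartProd_cons, mul_add, mul_smul_comm, ← mul_assoc (d.weight r),
    hprod, zero_mul, smul_zero, add_zero, d.weight_rev, smul_mul_assoc, ← add_smul,
    neg_add_cancel, zero_smul]

theorem dartProd_mem_supported {S : Set X} {L : List (Dart X)} (h : ∀ d ∈ L, d.1 ∈ S) :
    dartProd r L ∈ Lam.supported r S :=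
  list_prod_mem (List.forall_mem_map.2 fun d hd => Dart.weight_mem_supported (h d hd))

theorem dartSum_mem_supported {S : Set X} {L : List (Dart X)} (h : ∀ d ∈ L, d.1 ∈ S) :
    dartSum r L ∈ Lam.supported r S := by
  induction L with
  | nil => exact zero_mem _
  | cons d L ih =>
    rw [List.forall_mem_cons] at h
    exact add_mem (dartProd_mem_supported h.2)
      (zsmul_mem (mul_mem (Dart.weight_mem_supported h.1) (ih h.2)) _)

theorem twist_dartProd (L : List (Dart X)) :
    Lam.twist (dartProd r L) = commSign r ^ L.length • dartProd r L := by
  induction L with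
  | nil => simp
  | cons d L ih =>
    rw [dartProd_cons, map_mul, ih, Dart.twist_weight, smul_mul_smul_comm, List.length_cons,
      pow_succ']

theorem twist_dartSum (L : List (Dart X)) :
    Lam.twist (dartSum r L) = commSign r ^ (L.length + 1) • dartSum r L := by
  induction L with
  | nil => simp
  | cons d L ih =>
    have hsq : commSign r ^ (L.length + 1 + 1) = commSign r ^ L.length := by
      rw [pow_succ, pow_succ, mul_assoc, commSign_mul_self, mul_one]
    rw [dartSum_cons, map_add, map_zsmul, map_mul, ih, twist_dartProd, Dart.twist_weight,
      smul_mul_smul_comm, smul_add, List.length_cons, hsq, smul_smul, smul_smul, ← pow_succ', hsq,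
      ← pow_succ', ← pow_succ]

theorem dartSum_cons_eq_smul_append (d : Dart X) (L : List (Dart X)) :
    dartSum r (d :: L) = commSign r ^ L.length • dartSum r (L ++ [d]) := by
  rw [dartSum_cons, dartSum_append, dartSum_singleton, d.weight_mul, twist_dartSum, smul_add,
    smul_smul, ← mul_pow, commSign_mul_self, one_pow, one_smul, smul_mul_assoc, smul_smul,
    pow_succ', ← mul_assoc, commSign_mul_self, one_mul, mul_one, add_comm]
  simp

theorem dartSum_append_comm (L M : List (Dart X)) :
    dartSum r (L ++ M) = commSign r ^ (L.length * M.length) • dartSum r (M ++ L) := by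
  induction L generalizing M with
  | nil => simp
  | cons d L ih =>
    have hsq : commSign r ^ L.length * commSign r ^ L.length = 1 := by
      rw [← mul_pow, commSign_mul_self, one_pow]
    rw [List.cons_append, dartSum_cons_eq_smul_append, List.append_assoc, ih, smul_smul]
    simp only [List.length_append, List.length_nil, List.length_cons, zero_add, List.append_assoc,
      List.singleton_append, pow_add, mul_add, add_mul, mul_one, one_mul]
    congr 1
    linear_combination (commSign r ^ M.length * commSign r ^ (L.length * M.length)) * hsq

end Dart

section Walk

variable {r : ℕ} {X V X' V' : Type*} {s t : X → V} {S T : Set X}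

/-- `IsWalk s t S a L b`: the darts of `L` form a walk from `a` to `b` over the edges in `S`, the
ends of an edge `e` being `s e` and `t e`. -/
def IsWalk (s t : X → V) (S : Set X) : V → List (Dart X) → V → Prop
  | a, [], b => a = b
  | a, d :: L, b => d.1 ∈ S ∧ d.tail s t = a ∧ IsWalk s t S (d.head s t) L b

theorem IsWalk.mem {a b : V} {L : List (Dart X)} (h : IsWalk s t S a L b) :
    ∀ d ∈ L, d.1 ∈ S := by
  induction L generalizing a with
  | nil => simp
  | cons d L ih => exact List.forall_mem_cons.2 ⟨h.1, ih h.2.2⟩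

theorem IsWalk.of_forall_mem {a b : V} {L : List (Dart X)} (h : IsWalk s t S a L b)
    (hT : ∀ d ∈ L, d.1 ∈ T) : IsWalk s t T a L b := by
  induction L generalizing a with
  | nil => exact h
  | cons d L ih =>
    rw [List.forall_mem_cons] at hT
    exact ⟨hT.1, h.2.1, ih h.2.2 hT.2⟩

theorem isWalk_append {a c : V} {L M : List (Dart X)} :
    IsWalk s t S a (L ++ M) c ↔ ∃ b, IsWalk s t S a L b ∧ IsWalk s t S b M c := by
  induction L generalizing a with
  | nil => simp [IsWalk]
  | cons d L ih => simp [IsWalk, ih, and_assoc]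

theorem isWalk_singleton {d : Dart X} (hd : d.1 ∈ S) :
    IsWalk s t S (d.tail s t) [d] (d.head s t) := ⟨hd, rfl, rfl⟩

/-- The ideal of `Λ^r` generated by the Arnold classes of the closed walks over the edges
in `S`. -/
def walkIdeal (r : ℕ) (s t : X → V) (S : Set X) : TwoSidedIdeal (Lam r X) :=
  TwoSidedIdeal.span {x | ∃ a L, IsWalk s t S a L a ∧ x = dartSum r L}

theorem IsWalk.dartSum_mem {a : V} {L : List (Dart X)} (h : IsWalk s t S a L a) :
    dartSum r L ∈ walkIdeal r s t S := TwoSidedIdeal.subset_span ⟨a, L, h, rfl⟩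

theorem walkIdeal_le {I : TwoSidedIdeal (Lam r X)}
    (h : ∀ a L, IsWalk s t S a L a → dartSum r L ∈ I) : walkIdeal r s t S ≤ I :=
  TwoSidedIdeal.span_le.2 (by rintro _ ⟨a, L, hL, rfl⟩; exact h a L hL)

theorem walkIdeal_le_comap {s' t' : X' → V'} {S' : Set X'} (f : Lam r X →+* Lam r X')
    (p : V → V') (h : ∀ b ∈ S, ∃ d : Dart X', d.1 ∈ S' ∧ f (Lam.gen r b) = d.weight r ∧
      d.tail s' t' = p (s b) ∧ d.head s' t' = p (t b)) :
    walkIdeal r s t S ≤ (walkIdeal r s' t' S').comap f := by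
  have hdart : ∀ d : Dart X, d.1 ∈ S → ∃ d' : Dart X', d'.1 ∈ S' ∧ f (d.weight r) = d'.weight r ∧
      d'.tail s' t' = p (d.tail s t) ∧ d'.head s' t' = p (d.head s t) := by
    rintro ⟨b, _ | _⟩ hb <;> obtain ⟨d, hd, hf, hs, ht⟩ := h b hb
    · refine ⟨d.rev, hd, ?_, ?_, ?_⟩
      · rw [d.weight_rev, ← hf, ← map_zsmul]; simp [Dart.weight, Dart.sign]
      · rw [Dart.tail_rev, ht]; rfl
      · rw [Dart.head_rev, hs]; rfl
    · exact ⟨d, hd, by simpa using hf, hs, ht⟩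
  have hwalk : ∀ L a c, IsWalk s t S a L c → ∃ L', IsWalk s' t' S' (p a) L' (p c) ∧
      (L.map (Dart.weight r)).map f = L'.map (Dart.weight r) := by
    intro L
    induction L with
    | nil => rintro a _ rfl; exact ⟨[], rfl, rfl⟩
    | cons d L ih =>
      rintro a c ⟨hd, rfl, hL⟩
      obtain ⟨d', hd', hf, hs, ht⟩ := hdart d hd
      obtain ⟨L', hL', hf'⟩ := ih _ c hL
      exact ⟨d' :: L', ⟨hd', hs, ht ▸ hL'⟩, by simp [hf, ← hf']⟩
  refine walkIdeal_le fun a L hL => ?_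
  obtain ⟨L', hL', hf⟩ := hwalk L a a hL
  rw [TwoSidedIdeal.mem_comap, dartSum, map_arnoldSum, hf]
  exact hL'.dartSum_mem

theorem walkIdeal_mono (h : S ⊆ T) : walkIdeal r s t S ≤ walkIdeal r s t T :=
  walkIdeal_le_comap (RingHom.id _) id fun b hb => ⟨(b, true), h hb, by simp, rfl, rfl⟩

theorem ret_mem_walkIdeal (h : S ⊆ T) {x : Lam r X} (hx : x ∈ walkIdeal r s t S) :
    Lam.ret T x ∈ walkIdeal r s t S :=
  (TwoSidedIdeal.mem_comap _).1 <| walkIdeal_le_comap (Lam.ret T) id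
    (fun b hb => ⟨(b, true), hb, by simp [h hb], rfl, rfl⟩) hx

theorem twist_mem_walkIdeal {x : Lam r X} (hx : x ∈ walkIdeal r s t S) :
    Lam.twist x ∈ walkIdeal r s t S := by
  suffices walkIdeal r s t S ≤ (walkIdeal r s t S).comap Lam.twist from
    (TwoSidedIdeal.mem_comap _).1 (this hx)
  refine walkIdeal_le fun a L hL => ?_
  rw [TwoSidedIdeal.mem_comap, twist_dartSum]
  exact zsmul_mem hL.dartSum_mem _

theorem one_mem_walkIdeal {b : X} (hb : b ∈ S) (hloop : s b = t b) :
    1 ∈ walkIdeal r s t S := by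
  rw [← dartSum_singleton (b, true)]
  exact IsWalk.dartSum_mem (a := s b) ⟨hb, rfl, hloop.symm⟩

theorem IsWalk.dartProd_mem {a : V} {L : List (Dart X)} (h : IsWalk s t S a L a) (hL : L ≠ []) :
    dartProd r L ∈ walkIdeal r s t S := by
  obtain ⟨d, L, rfl⟩ := List.exists_cons_of_ne_nil hL
  have hmul : d.weight r * dartSum r (d :: L) = dartProd r (d :: L) := by
    rw [dartSum_cons, mul_add, mul_smul_comm, ← mul_assoc, Dart.weight_mul_weight rfl, zero_mul,
      smul_zero, add_zero, dartProd_cons]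
  exact hmul ▸ TwoSidedIdeal.mul_mem_left _ _ _ h.dartSum_mem

end Walk

section Collapse

variable {r : ℕ} {X V : Type*} {s t : X → V} {S : Set X} {α : X}

open Classical in
/-- The map of vertices that moves `p` to `q` and so identifies the two. -/
def collapse (p q : V) : V → V := Function.update id p q

theorem collapse_left (p q : V) : collapse p q p = q := by simp [collapse]

theorem collapse_right (p q : V) : collapse p q q = q := by
  by_cases h : q = p <;> simp [collapse, h]

theorem exists_dart_of_collapse_eq {x y : V}
    (h : collapse (s α) (t α) x = collapse (s α) (t α) y) :
    x = y ∨ ∃ d : Dart X, d.1 = α ∧ d.tail s t = x ∧ d.head s t = y := by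
  by_cases hx : x = s α <;> by_cases hy : y = s α
  · exact .inl (hx.trans hy.symm)
  · exact .inr ⟨(α, true), rfl, hx.symm, by simpa [collapse, hx, hy, Dart.head] using h⟩
  · exact .inr ⟨(α, false), rfl, by simpa [collapse, hx, hy, Dart.tail] using h.symm, hy.symm⟩
  · exact .inl (by simpa [collapse, hx, hy] using h)

theorem collapse_tail_eq_collapse_head {d : Dart X} (hd : d.1 = α) :
    collapse (s α) (t α) (d.tail s t) = collapse (s α) (t α) (d.head s t) := by
  subst hd
  obtain ⟨b, _ | _⟩ := d <;> simp [Dart.tail, Dart.head, collapse_left, collapse_right]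

theorem Dart.tail_comp {V' : Type*} (c : V → V') (d : Dart X) :
    d.tail (c ∘ s) (c ∘ t) = c (d.tail s t) := (apply_ite c _ _ _).symm

theorem Dart.head_comp {V' : Type*} (c : V → V') (d : Dart X) :
    d.head (c ∘ s) (c ∘ t) = c (d.head s t) := (apply_ite c _ _ _).symm

/-- The ideal of the graph `Γ / α`, as an ideal of the algebra on the edges of `Γ`. -/
abbrev contrIdeal (r : ℕ) (s t : X → V) (S : Set X) (α : X) : TwoSidedIdeal (Lam r X) :=
  walkIdeal r (collapse (s α) (t α) ∘ s) (collapse (s α) (t α) ∘ t) (S \ {α})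

open Classical in
theorem IsWalk.filter_ne {a b : V} {L : List (Dart X)} (h : IsWalk s t S a L b) :
    IsWalk (collapse (s α) (t α) ∘ s) (collapse (s α) (t α) ∘ t) (S \ {α})
      (collapse (s α) (t α) a) (L.filter (·.1 ≠ α)) (collapse (s α) (t α) b) := by
  induction L generalizing a with
  | nil => exact congrArg _ h
  | cons d L ih =>
    obtain ⟨hd, rfl, hL⟩ := h
    by_cases hα : d.1 = α
    · simpa [hα, collapse_tail_eq_collapse_head hα] using ih hL
    · simpa [hα, IsWalk, hd, Dart.tail_comp, Dart.head_comp] using ih hL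

open Classical in
/-- The idea is to move all occurrences of `e_α` to the right. -/
theorem exists_eq_filter_mul (α : X) (L : List (Dart X)) : ∃ k k' : Lam r X,
    dartProd r L = dartProd r (L.filter (·.1 ≠ α)) * k ∧
    dartSum r L = dartSum r (L.filter (·.1 ≠ α)) * k + dartProd r (L.filter (·.1 ≠ α)) * k' := by
  induction L with
  | nil => exact ⟨1, 0, by simp, by simp⟩
  | cons d L ih =>
    obtain ⟨k, k', hk, hk'⟩ := ih
    by_cases hd : d.1 = α
    · set M := L.filter (·.1 ≠ α)
      refine ⟨commSign r ^ M.length • (d.weight r * k),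
        k + commSign r ^ (M.length + 1) • (d.weight r * k'), ?_, ?_⟩
      · rw [List.filter_cons_of_neg (by simpa using hd), dartProd_cons, hk, ← mul_assoc,
          d.weight_mul, twist_dartProd, smul_mul_assoc, smul_mul_assoc, mul_smul_comm, mul_assoc]
      · rw [List.filter_cons_of_neg (by simpa using hd), dartSum_cons, hk, hk', mul_add,
          ← mul_assoc, d.weight_mul, twist_dartSum, ← mul_assoc (d.weight r), d.weight_mul,
          twist_dartProd]
        simp only [smul_mul_assoc, mul_smul_comm, mul_assoc, smul_add, smul_smul, mul_add,
          pow_succ']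
        rw [← mul_assoc, commSign_mul_self, one_mul]
        abel
    · refine ⟨k, commSign r • k', ?_, ?_⟩
      · rw [List.filter_cons_of_pos (by simpa using hd), dartProd_cons, dartProd_cons, hk,
          mul_assoc]
      · rw [List.filter_cons_of_pos (by simpa using hd), dartSum_cons, dartSum_cons, dartProd_cons,
          hk, hk']
        simp only [mul_add, add_mul, smul_add, smul_mul_assoc, mul_smul_comm, mul_assoc, add_assoc]

theorem dartSum_eq_zero_of_isWalk_singleton (hα : s α ≠ t α) {a : V} {L : List (Dart X)}
    (h : IsWalk s t {α} a L a) : dartSum r L = 0 := by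
  match L, h with
  | [], _ => rfl
  | [(_, true)], ⟨rfl, ha, ha'⟩ => exact absurd (ha.trans ha'.symm) hα
  | [(_, false)], ⟨rfl, ha, ha'⟩ => exact absurd (ha'.trans ha.symm) hα
  | (_, true) :: (_, true) :: _, ⟨rfl, _, rfl, h, _⟩ => exact absurd h hα
  | (_, false) :: (_, false) :: _, ⟨rfl, _, rfl, h, _⟩ => exact absurd h.symm hα
  | (_, true) :: (_, false) :: L, ⟨rfl, _, rfl, _, _⟩ => exact dartSum_cons_rev_cons (_, true) L
  | (_, false) :: (_, true) :: L, ⟨rfl, _, rfl, _, _⟩ => exact dartSum_cons_rev_cons (_, false) L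

theorem walkIdeal_le_contrIdeal (hα : s α ≠ t α) :
    walkIdeal r s t S ≤ contrIdeal r s t S α := by
  classical
  refine walkIdeal_le fun a L hL => ?_
  obtain ⟨k, k', -, hk⟩ := exists_eq_filter_mul (r := r) α L
  have hM := hL.filter_ne (α := α)
  by_cases hnil : L.filter (·.1 ≠ α) = []
  · have hα' : ∀ d ∈ L, d.1 = α := by simpa using hnil
    rw [dartSum_eq_zero_of_isWalk_singleton hα (hL.of_forall_mem hα')]
    exact zero_mem _
  · rw [hk]
    exact add_mem (TwoSidedIdeal.mul_mem_right _ _ _ hM.dartSum_mem)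
      (TwoSidedIdeal.mul_mem_right _ _ _ (hM.dartProd_mem hnil))

theorem coeff_mem_walkIdeal (hα : α ∉ S) {x : Lam r X} (hx : x ∈ walkIdeal r s t S) :
    Lam.coeff α x ∈ walkIdeal r s t S := by
  have hret {x : Lam r X} (hx : x ∈ walkIdeal r s t S) :
      Lam.ret {α}ᶜ x ∈ walkIdeal r s t S :=
    ret_mem_walkIdeal (Set.subset_compl_singleton_iff.2 hα) hx
  induction hx using TwoSidedIdeal.span_induction with
  | mem x hx =>
    obtain ⟨a, L, hL, rfl⟩ := hx
    rw [Lam.coeff_eq_zero (dartSum_mem_supported fun d hd => ?_)]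
    · exact zero_mem _
    · exact fun h => hα (h ▸ hL.mem d hd)
  | zero => rw [map_zero]; exact zero_mem _
  | add x y _ _ hx hy => rw [map_add]; exact add_mem hx hy
  | neg x _ hx => rw [map_neg]; exact neg_mem hx
  | left_absorb a x hx ih =>
    rw [Lam.coeff_mul]
    exact add_mem (TwoSidedIdeal.mul_mem_left _ _ _ ih)
      (TwoSidedIdeal.mul_mem_left _ _ _ (twist_mem_walkIdeal (hret hx)))
  | right_absorb a x hx ih =>
    rw [Lam.coeff_mul]
    exact add_mem (TwoSidedIdeal.mul_mem_right _ _ _ (hret hx))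
      (TwoSidedIdeal.mul_mem_right _ _ _ ih)

theorem coeff_mem_contrIdeal (hα : s α ≠ t α) {x : Lam r X} (hx : x ∈ walkIdeal r s t S) :
    Lam.coeff α x ∈ contrIdeal r s t S α :=
  coeff_mem_walkIdeal (by simp) (walkIdeal_le_contrIdeal hα hx)

end Collapse

section Lifting

variable {r : ℕ} {X V : Type*} {s t : X → V} {S : Set X} {α : X}

theorem collapse_eq_collapse {p q x y : V} (h : collapse p q x = collapse p q y) :
    x = y ∨ collapse p q x = q ∧ collapse p q y = q := by
  by_cases hx : x = p <;> by_cases hy : y = p <;> simp_all [collapse]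

theorem IsWalk.comp {V' : Type*} (c : V → V') {a b : V} {L : List (Dart X)}
    (h : IsWalk s t S a L b) : IsWalk (c ∘ s) (c ∘ t) S (c a) L (c b) := by
  induction L generalizing a with
  | nil => exact congrArg c h
  | cons d L ih =>
    refine ⟨h.1, (d.tail_comp c).trans (congrArg c h.2.1), ?_⟩
    rw [d.head_comp]
    exact ih h.2.2

theorem IsWalk.mono {T : Set X} (hST : S ⊆ T) {a b : V} {L : List (Dart X)}
    (h : IsWalk s t S a L b) : IsWalk s t T a L b := h.of_forall_mem fun d hd => hST (h.mem d hd)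

/-- The elements `v` of `Λ^r` such that `v e_α` is congruent, modulo the ideal of the closed walks
over `S`, to an element in which `e_α` does not occur. -/
def liftable (r : ℕ) (s t : X → V) (S : Set X) (α : X) : AddSubgroup (Lam r X) where
  carrier := {v | ∃ u ∈ Lam.supported r (S \ {α}), v * Lam.gen r α - u ∈ walkIdeal r s t S}
  zero_mem' := ⟨0, zero_mem _, by rw [zero_mul, sub_zero]; exact zero_mem _⟩
  add_mem' := by
    rintro v v' ⟨u, hu, hv⟩ ⟨u', hu', hv'⟩
    exact ⟨u + u', add_mem hu hu', by rw [add_mul, add_sub_add_comm]; exact add_mem hv hv'⟩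
  neg_mem' := by
    rintro v ⟨u, hu, hv⟩
    exact ⟨-u, neg_mem hu, by rw [neg_mul, neg_sub_neg, ← neg_sub]; exact neg_mem hv⟩

theorem mul_mem_liftable_left {a v : Lam r X} (ha : a ∈ Lam.supported r (S \ {α}))
    (hv : v ∈ liftable r s t S α) : a * v ∈ liftable r s t S α := by
  obtain ⟨u, hu, h⟩ := hv
  refine ⟨a * u, mul_mem ha hu, ?_⟩
  rw [mul_assoc, ← mul_sub]
  exact TwoSidedIdeal.mul_mem_left _ _ _ h

theorem mul_mem_liftable_right {a v : Lam r X} (ha : a ∈ Lam.supported r (S \ {α}))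
    (hv : v ∈ liftable r s t S α) : v * a ∈ liftable r s t S α := by
  obtain ⟨u, hu, h⟩ := hv
  refine ⟨u * Lam.twist a, mul_mem hu (Lam.twist_mem_supported ha), ?_⟩
  have hcomm : a * Lam.gen r α = Lam.gen r α * Lam.twist a := by
    rw [Lam.gen_mul, Lam.twist_twist]
  rw [mul_assoc, hcomm, ← mul_assoc, ← sub_mul]
  exact TwoSidedIdeal.mul_mem_right _ _ _ h

theorem dartSum_append_mem_liftable {L M : List (Dart X)} (hL : ∀ d ∈ L, d.1 ∈ S \ {α})
    (hM : ∀ d ∈ M, d.1 ∈ S \ {α}) (hL' : dartSum r L ∈ liftable r s t S α)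
    (hM' : dartSum r M ∈ liftable r s t S α) : dartSum r (L ++ M) ∈ liftable r s t S α := by
  rw [dartSum_append]
  exact add_mem (mul_mem_liftable_right (dartProd_mem_supported hM) hL')
    (zsmul_mem (mul_mem_liftable_left (dartProd_mem_supported hL) hM') _)

/-- A walk in `Γ ∖ α` that becomes closed in `Γ / α` either is closed or is closed up by `α`. -/
theorem IsWalk.dartSum_mem_liftable (hα : α ∈ S) {a b : V} {L : List (Dart X)}
    (h : IsWalk s t (S \ {α}) a L b)
    (hab : collapse (s α) (t α) a = collapse (s α) (t α) b) :
    dartSum r L ∈ liftable r s t S α := by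
  have hL := h.mono (T := S) Set.sdiff_subset
  rcases exists_dart_of_collapse_eq hab.symm with rfl | ⟨d, rfl, rfl, rfl⟩
  · refine ⟨0, zero_mem _, ?_⟩
    rw [sub_zero]
    exact TwoSidedIdeal.mul_mem_right _ _ _ hL.dartSum_mem
  · have hclosed := isWalk_append.2 ⟨_, hL, isWalk_singleton hα⟩
    refine ⟨-(d.sign r • commSign r ^ L.length • dartProd r L),
      neg_mem (zsmul_mem (zsmul_mem (dartProd_mem_supported h.mem) _) _), ?_⟩
    have : dartSum r L * Lam.gen r d.1 - -(d.sign r • commSign r ^ L.length • dartProd r L) =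
        d.sign r • dartSum r (L ++ [d]) := by
      rw [dartSum_append, dartSum_singleton, ← d.sign_smul_weight]
      simp [-zsmul_eq_mul, mul_smul_comm]
    exact this ▸ zsmul_mem hclosed.dartSum_mem _

/-- The walk `L` in `Γ / α` is read from left to right, and `P` is the part since the last passage
through the vertex to which `α` is contracted. -/
theorem dartSum_append_mem_liftable_of_collapse_eq (hα : α ∈ S) {a b : V}
    {P L : List (Dart X)} (hP : IsWalk s t (S \ {α}) a P b)
    (hL : IsWalk (collapse (s α) (t α) ∘ s) (collapse (s α) (t α) ∘ t) (S \ {α})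
      (collapse (s α) (t α) b) L (t α)) (ha : collapse (s α) (t α) a = t α) :
    dartSum r (P ++ L) ∈ liftable r s t S α := by
  induction L generalizing a b P with
  | nil => simpa using hP.dartSum_mem_liftable hα (ha.trans hL.symm)
  | cons d L ih =>
    obtain ⟨hd, htail, hL'⟩ := id hL
    rw [Dart.head_comp] at hL'
    rw [Dart.tail_comp] at htail
    have hdwalk := isWalk_singleton (s := s) (t := t) hd
    rcases collapse_eq_collapse htail with rfl | ⟨hd', hb⟩
    · simpa using ih (isWalk_append.2 ⟨_, hP, hdwalk⟩) hL' ha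
    · exact dartSum_append_mem_liftable hP.mem hL.mem
        (hP.dartSum_mem_liftable hα (ha.trans hb.symm)) (ih hdwalk hL' hd')

theorem dartSum_append_mem_liftable_of_isWalk (hα : α ∈ S) {a b : V} {P L : List (Dart X)}
    (hP : IsWalk s t (S \ {α}) a P b)
    (hL : IsWalk (collapse (s α) (t α) ∘ s) (collapse (s α) (t α) ∘ t) (S \ {α})
      (collapse (s α) (t α) b) L (collapse (s α) (t α) a)) :
    dartSum r (P ++ L) ∈ liftable r s t S α := by
  induction L generalizing b P with
  | nil => simpa using hP.dartSum_mem_liftable hα hL.symm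
  | cons d L ih =>
    obtain ⟨hd, htail, hL'⟩ := hL
    rw [Dart.head_comp] at hL'
    rw [Dart.tail_comp] at htail
    have hdwalk := isWalk_singleton (s := s) (t := t) hd
    rcases collapse_eq_collapse htail with rfl | ⟨hd', hb⟩
    · simpa using ih (isWalk_append.2 ⟨_, hP, hdwalk⟩) hL'
    · -- The walk passes through the contracted vertex and is rotated to start there.
      have hLP := isWalk_append.2 ⟨_, hL', hb ▸ hP.comp (collapse (s α) (t α))⟩
      rw [dartSum_append_comm]
      exact zsmul_mem (dartSum_append_mem_liftable_of_collapse_eq hα hdwalk hLP hd') _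

theorem ret_mem_liftable (hα : α ∈ S) {v : Lam r X} (hv : v ∈ contrIdeal r s t S α) :
    Lam.ret (S \ {α}) v ∈ liftable r s t S α := by
  have hret (x : Lam r X) : Lam.ret (S \ {α}) x ∈ Lam.supported r (S \ {α}) := by
    simpa using Lam.ret_mem_supported (S := S \ {α}) (Lam.mem_supported_univ x)
  induction hv using TwoSidedIdeal.span_induction with
  | mem x hx =>
    obtain ⟨a, L, hL, rfl⟩ := hx
    rw [Lam.mem_supported.1 (dartSum_mem_supported hL.mem)]
    match L, hL with
    | [], _ => exact zero_mem _
    | d :: L, ⟨hd, htail, hL⟩ =>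
      rw [Dart.tail_comp] at htail
      rw [Dart.head_comp, ← htail] at hL
      exact dartSum_append_mem_liftable_of_isWalk hα (isWalk_singleton hd) hL
  | zero => rw [map_zero]; exact zero_mem _
  | add x y _ _ hx hy => rw [map_add]; exact add_mem hx hy
  | neg x _ hx => rw [map_neg]; exact neg_mem hx
  | left_absorb a x _ hx => rw [map_mul]; exact mul_mem_liftable_left (hret a) hx
  | right_absorb a x _ hx => rw [map_mul]; exact mul_mem_liftable_right (hret a) hx

theorem exists_sub_mem_walkIdeal (hα : α ∈ S) {x : Lam r X} (hx : x ∈ Lam.supported r S)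
    (hcoeff : Lam.coeff α x ∈ contrIdeal r s t S α) :
    ∃ y ∈ Lam.supported r (S \ {α}), x - y ∈ walkIdeal r s t S := by
  obtain ⟨u, hu, huv⟩ := Lam.mem_supported.1 (Lam.coeff_mem_supported hx) ▸
    ret_mem_liftable hα hcoeff
  have hret : Lam.ret {α}ᶜ x ∈ Lam.supported r (S \ {α}) := by
    rw [Set.sdiff_eq, Set.inter_comm]
    exact Lam.ret_mem_supported hx
  refine ⟨Lam.ret {α}ᶜ x + u, add_mem hret hu, ?_⟩
  rwa [← sub_sub, sub_eq_of_eq_add' (Lam.eq_ret_add_coeff_mul_gen α x)]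

end Lifting

section Injectivity

variable {r : ℕ} {X Y V : Type*} {s t : X → V} {S T : Set X} {α : X}

/-- The ring homomorphism that replaces each edge by a dart. -/
def Lam.subst (φ : X → Dart Y) : Lam r X →+* Lam r Y :=
  Lam.lift (fun a => (φ a).weight r) (fun _ => Dart.weight_mul_weight rfl)
    (fun a b => by rw [Dart.weight_mul, Dart.twist_weight, smul_mul_assoc])

@[simp] theorem Lam.subst_gen (φ : X → Dart Y) (a : X) :
    Lam.subst φ (Lam.gen r a) = (φ a).weight r := by simp [Lam.subst]

theorem Lam.subst_eq_self {φ : X → Dart X} (hφ : ∀ a ∈ T, φ a = (a, true)) {x : Lam r X}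
    (hx : x ∈ Lam.supported r T) : Lam.subst φ x = x := by
  have : (Lam.subst φ).comp (Lam.ret T) = Lam.ret (r := r) T :=
    Lam.hom_ext fun a => by by_cases ha : a ∈ T <;> simp [ha, hφ]
  rw [← Lam.mem_supported.1 hx]
  exact congr($this x)

theorem ret_empty_eq_zero (hloop : ∀ b ∈ S, s b ≠ t b) {x : Lam r X}
    (hx : x ∈ walkIdeal r s t S) : Lam.ret ∅ x = 0 := by
  have hweight (d : Dart X) : Lam.ret ∅ (d.weight r) = 0 := by simp [Dart.weight]
  suffices walkIdeal r s t S ≤ TwoSidedIdeal.ker (Lam.ret ∅) from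
    (TwoSidedIdeal.mem_ker _).1 (this hx)
  refine walkIdeal_le fun a L hL => (TwoSidedIdeal.mem_ker _).2 ?_
  match L, hL with
  | [], _ => exact map_zero _
  | [(b, true)], ⟨hb, ha, ha'⟩ => exact absurd (ha.trans ha'.symm) (hloop b hb)
  | [(b, false)], ⟨hb, ha, ha'⟩ => exact absurd (ha'.trans ha.symm) (hloop b hb)
  | d :: e :: L, _ => simp [dartSum, map_arnoldSum, arnoldSum, hweight]

/-- Replacing the edges outside `T` that are parallel to `α` by `α` fixes `x`. -/
theorem mem_walkIdeal_of_parallel (hloop : ∀ b ∈ S, s b ≠ t b) (hT : T ⊆ S) (hα : α ∈ T)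
    {x : Lam r X} (hx : x ∈ walkIdeal r s t S) (hxT : x ∈ Lam.supported r T) :
    x ∈ walkIdeal r s t
      {b ∈ S | collapse (s α) (t α) (s b) = collapse (s α) (t α) (t b) → b ∈ T} := by
  set S' := {b ∈ S | collapse (s α) (t α) (s b) = collapse (s α) (t α) (t b) → b ∈ T}
  have hdart : ∀ b, ∃ d : Dart X, (b ∈ T → d = (b, true)) ∧
      (b ∈ S → d.1 ∈ S' ∧ d.tail s t = s b ∧ d.head s t = t b) := by
    intro b
    by_cases hb : b ∈ S ∧ collapse (s α) (t α) (s b) = collapse (s α) (t α) (t b) ∧ b ∉ T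
    · obtain ⟨hbS, hpar, hbT⟩ := hb
      rcases exists_dart_of_collapse_eq hpar with h | ⟨d, rfl, htail, hhead⟩
      · exact absurd h (hloop b hbS)
      · exact ⟨d, fun h => absurd h hbT, fun _ => ⟨⟨hT hα, fun _ => hα⟩, htail, hhead⟩⟩
    · refine ⟨(b, true), fun _ => rfl, fun hbS => ⟨⟨hbS, fun hpar => ?_⟩, rfl, rfl⟩⟩
      exact by_contra fun hbT => hb ⟨hbS, hpar, hbT⟩
  choose φ hφT hφS using hdart
  rw [← Lam.subst_eq_self hφT hxT]
  exact (TwoSidedIdeal.mem_comap _).1 <| walkIdeal_le_comap (Lam.subst φ) id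
    (fun b hb => ⟨φ b, (hφS b hb).1, Lam.subst_gen .., (hφS b hb).2⟩) hx

theorem mem_walkIdeal_of_finite (hT : T.Finite) (hTS : T ⊆ S) (hloop : ∀ b ∈ S, s b ≠ t b)
    {x : Lam r X} (hx : x ∈ walkIdeal r s t S) (hxT : x ∈ Lam.supported r T) :
    x ∈ walkIdeal r s t T := by
  induction T, hT using Set.Finite.induction_on generalizing s t S x with
  | empty =>
    rw [← Lam.mem_supported.1 hxT, ret_empty_eq_zero hloop hx]
    exact zero_mem _
  | @insert α T hα _ ih =>
    have hαS : α ∈ S := hTS (T.mem_insert α)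
    have hdiff : insert α T \ {α} = T := Set.insert_sdiff_self_of_notMem hα
    have hcoeff := coeff_mem_contrIdeal (hloop α hαS)
      (mem_walkIdeal_of_parallel hloop hTS (T.mem_insert α) hx hxT)
    have hcoeffT := Lam.coeff_mem_supported (a := α) hxT
    have hcontr : Lam.coeff α x ∈ contrIdeal r s t (insert α T) α := by
      rw [hdiff] at hcoeffT
      rw [contrIdeal, hdiff]
      by_cases h : ∃ b ∈ T, collapse (s α) (t α) (s b) = collapse (s α) (t α) (t b)
      · obtain ⟨b, hb, hpar⟩ := h
        simpa using TwoSidedIdeal.mul_mem_left _ (Lam.coeff α x) _ (one_mem_walkIdeal hb hpar)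
      · push Not at h
        refine ih ?_ ?_ hcoeff hcoeffT
        · exact fun b hb => ⟨⟨hTS (.inr hb), fun _ => .inr hb⟩, ne_of_mem_of_not_mem hb hα⟩
        · rintro b ⟨⟨-, hbT⟩, hbα⟩ hpar
          exact h b ((hbT hpar).resolve_left hbα) hpar
    obtain ⟨y, hy, hxy⟩ := exists_sub_mem_walkIdeal (T.mem_insert α) hxT hcontr
    rw [hdiff] at hy
    have hyS : y ∈ walkIdeal r s t S := by
      simpa using sub_mem hx (walkIdeal_mono hTS hxy)
    have hyT := ih ((T.subset_insert α).trans hTS) hloop hyS hy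
    simpa using add_mem hxy (walkIdeal_mono (T.subset_insert α) hyT)

theorem mem_walkIdeal_of_mem_supported (hTS : T ⊆ S) (hloop : ∀ b ∈ S, s b ≠ t b)
    {x : Lam r X} (hx : x ∈ walkIdeal r s t S) (hxT : x ∈ Lam.supported r T) :
    x ∈ walkIdeal r s t T := by
  obtain ⟨F, hF⟩ := Lam.exists_finset_mem_supported x
  have hxFT : x ∈ Lam.supported r (↑F ∩ T) := by
    rw [← Lam.mem_supported.1 hF]
    exact Lam.ret_mem_supported hxT
  exact walkIdeal_mono Set.inter_subset_right <| mem_walkIdeal_of_finite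
    (F.finite_toSet.inter_of_left T) (Set.inter_subset_right.trans hTS) hloop hx hxFT

end Injectivity

section Circuit

variable {r : ℕ} {V E : Type*} {Γ : Graph V E} {o : E → V} {s t : E(Γ) → V}

/-- `s` and `t` give the first and the second end of every edge, for `r` odd in accordance with
the orientation `o`. -/
structure IsEnds (r : ℕ) (Γ : Graph V E) (o : E → V) (s t : E(Γ) → V) : Prop where
  link : ∀ b : E(Γ), Γ.IsLink (b : E) (s b) (t b)
  first : Odd r → ∀ b : E(Γ), s b = o b

theorem exists_isEnds (ho : Odd r → IsOrientation Γ o) : ∃ s t, IsEnds r Γ o s t := by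
  have hlink (b : E(Γ)) : ∃ x y, Γ.IsLink (b : E) x y ∧ (Odd r → x = o b) := by
    by_cases hr : Odd r
    · obtain ⟨y, hy⟩ := ho hr b b.2
      exact ⟨_, y, hy, fun _ => rfl⟩
    · obtain ⟨x, y, hxy⟩ := Γ.exists_isLink_of_mem_edgeSet b.2
      exact ⟨x, y, hxy, fun h => absurd h hr⟩
  choose s t hst hs using hlink
  exact ⟨s, t, hst, fun hr b => hs b hr⟩

theorem IsEnds.isLink_dart (h : IsEnds r Γ o s t) (d : Dart E(Γ)) :
    Γ.IsLink (d.1 : E) (d.tail s t) (d.head s t) := by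
  obtain ⟨b, _ | _⟩ := d
  exacts [(h.link b).symm, h.link b]

theorem arnoldSign_succ (b : E(Γ)) (w : List E(Γ)) (v : ℕ → V) (i : Fin w.length) :
    arnoldSign r o (b :: w) v i.succ =
      commSign r • arnoldSign r o w (fun j => v (j + 1)) i := by
  by_cases hr : Even r
  · simp [arnoldSign, commSign, hr, hr.add_one.neg_one_pow, pow_succ]
  · simp [arnoldSign, commSign, hr, (Nat.not_even_iff_odd.1 hr).add_one.neg_one_pow]

theorem arnold_cons (b : E(Γ)) (w : List E(Γ)) (v : ℕ → V) :
    arnold r o (b :: w) v = arnoldSign r o (b :: w) v 0 * Lam.mon r w +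
      commSign r • (Lam.gen r b * arnold r o w (fun i => v (i + 1))) := by
  refine (Fin.sum_univ_succ _).trans ?_
  simp only [arnold, Finset.mul_sum, Finset.smul_sum]
  refine congrArg (_ + ·) (Finset.sum_congr rfl fun i _ => ?_)
  have hcomm : Commute (Lam.gen r b) (arnoldSign r o w (fun j => v (j + 1)) i) := by
    unfold arnoldSign
    split_ifs
    exacts [(Commute.neg_one_right _).pow_right _, Commute.one_right _, Commute.neg_one_right _]
  have hmon : Lam.mon r ((b :: w).eraseIdx (i.succ : ℕ)) =
      Lam.gen r b * Lam.mon r (w.eraseIdx i) := by simp [Lam.mon]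
  rw [arnoldSign_succ, hmon, smul_mul_assoc, hcomm.left_comm]

theorem IsEnds.arnoldSign_cons_zero (h : IsEnds r Γ o s t) {d : Dart E(Γ)} {w : List E(Γ)}
    {v : ℕ → V} (hd : d.2 = true ↔ s d.1 = v 0) :
    arnoldSign r o (d.1 :: w) v 0 = d.sign r := by
  by_cases hr : Even r
  · simp [arnoldSign, Dart.sign, commSign, hr, hr.add_one.neg_one_pow]
  · have hodd := Nat.not_even_iff_odd.1 hr
    rw [h.first hodd] at hd
    by_cases hv : o d.1 = v 0
    · simp [arnoldSign, Dart.sign, hr, hv, hd.2 hv]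
    · simp [arnoldSign, Dart.sign, commSign, hr, hodd.add_one.neg_one_pow, hv, mt hd.1 hv]

theorem exists_mon_arnold_eq_smul (h : IsEnds r Γ o s t) (L : List (Dart E(Γ))) (v : ℕ → V)
    (hv : ∀ (i : ℕ) (hi : i < L.length), L[i].2 = true ↔ s L[i].1 = v i) :
    ∃ n : ℤ, n * n = 1 ∧ Lam.mon r (L.map Prod.fst) = n • dartProd r L ∧
      arnold r o (L.map Prod.fst) v = n • dartSum r L := by
  induction L generalizing v with
  | nil => exact ⟨1, one_mul 1, by simp [Lam.mon], (Fin.sum_univ_zero _).trans (smul_zero _).symm⟩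
  | cons d L ih =>
    obtain ⟨n, hn, hmon, harnold⟩ :=
      ih (fun i => v (i + 1)) fun i hi => hv (i + 1) (Nat.succ_lt_succ hi)
    refine ⟨d.sign r * n, by rw [mul_mul_mul_comm, hn, d.sign_mul_self, one_mul], ?_, ?_⟩
    · rw [List.map_cons, Lam.mon, List.map_cons, List.prod_cons, ← Lam.mon, hmon,
        ← d.sign_smul_weight, smul_mul_smul_comm, dartProd_cons]
    · rw [List.map_cons, arnold_cons, hmon, harnold,
        h.arnoldSign_cons_zero (d := d) (hv 0 (Nat.succ_pos _)), ← d.sign_smul_weight,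
        smul_mul_smul_comm, dartSum_cons, smul_add, smul_comm (commSign r), ← zsmul_eq_mul,
        smul_smul]

theorem IsEnds.exists_isWalk (h : IsEnds r Γ o s t) (w : List E(Γ)) (v : ℕ → V)
    (hlink : ∀ (i : ℕ) (hi : i < w.length), Γ.IsLink (w[i] : E) (v i) (v (i + 1))) :
    ∃ L : List (Dart E(Γ)), L.map Prod.fst = w ∧ IsWalk s t Set.univ (v 0) L (v w.length) ∧
      ∀ (i : ℕ) (hi : i < L.length), L[i].2 = true ↔ s L[i].1 = v i := by
  classical
  induction w generalizing v with
  | nil => exact ⟨[], rfl, rfl, by simp⟩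
  | cons b w ih =>
    obtain ⟨L, rfl, hL, hv⟩ :=
      ih (fun i => v (i + 1)) fun i hi => hlink (i + 1) (Nat.succ_lt_succ hi)
    have hb : Γ.IsLink (b : E) (v 0) (v 1) := hlink 0 (Nat.succ_pos _)
    have hd : Dart.tail s t (b, decide (s b = v 0)) = v 0 ∧
        Dart.head s t (b, decide (s b = v 0)) = v 1 := by
      by_cases hs : s b = v 0
      · simpa [Dart.tail, Dart.head, hs] using (hs ▸ h.link b).right_unique hb
      · obtain ⟨hne, -⟩ | ⟨ht, hs'⟩ := (h.link b).eq_and_eq_or_eq_and_eq hb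
        · exact absurd hne hs
        · simpa [Dart.tail, Dart.head, hs] using ⟨hs', ht⟩
    refine ⟨(b, decide (s b = v 0)) :: L, rfl, ⟨Set.mem_univ _, hd.1, ?_⟩, ?_⟩
    · rw [hd.2]; exact hL
    · rintro (_ | i) hi
      · exact decide_eq_true_iff
      · exact hv i (Nat.lt_of_succ_lt_succ hi)

theorem IsWalk.exists_vertices (h : IsEnds r Γ o s t) (hloop : ∀ b, s b ≠ t b)
    {a c : V} {L : List (Dart E(Γ))} (hL : IsWalk s t Set.univ a L c) :
    ∃ v : ℕ → V, v 0 = a ∧ v L.length = c ∧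
      (∀ (i : ℕ) (hi : i < L.length), Γ.IsLink (L[i].1 : E) (v i) (v (i + 1))) ∧
      ∀ (i : ℕ) (hi : i < L.length), L[i].2 = true ↔ s L[i].1 = v i := by
  induction L generalizing a with
  | nil => exact ⟨fun _ => a, rfl, hL, by simp, by simp⟩
  | cons d L ih =>
    obtain ⟨-, rfl, hL⟩ := hL
    obtain ⟨v, hv0, hvlast, hlink, hv⟩ := ih hL
    refine ⟨fun i => i.casesOn (d.tail s t) v, rfl, hvlast, ?_, ?_⟩
    · rintro (_ | i) hi
      · simpa [hv0] using h.isLink_dart d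
      · exact hlink i (Nat.lt_of_succ_lt_succ hi)
    · rintro (_ | i) hi
      · obtain ⟨b, _ | _⟩ := d
        · simpa [Dart.tail] using hloop b
        · simp [Dart.tail]
      · exact hv i (Nat.lt_of_succ_lt_succ hi)

theorem dartSum_mem_arnoldIdeal (h : IsEnds r Γ o s t) {L : List (Dart E(Γ))} {v : ℕ → V}
    (hlink : ∀ (i : ℕ) (hi : i < L.length), Γ.IsLink (L[i].1 : E) (v i) (v (i + 1)))
    (hv : ∀ (i : ℕ) (hi : i < L.length), L[i].2 = true ↔ s L[i].1 = v i)
    (hclosed : v L.length = v 0) : dartSum r L ∈ arnoldIdeal r Γ o := by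
  obtain rfl | hL := eq_or_ne L []
  · exact zero_mem _
  have hcircuit : IsCircuit Γ (L.map Prod.fst) v :=
    ⟨by simpa using hL, by simpa using hlink, by simpa using hclosed⟩
  obtain ⟨n, hn, -, harnold⟩ := exists_mon_arnold_eq_smul h L v hv
  rw [← one_smul ℤ (dartSum r L), ← hn, mul_smul, ← harnold]
  have hmem : arnold r o (L.map Prod.fst) v ∈ arnoldIdeal r Γ o :=
    TwoSidedIdeal.subset_span ⟨_, v, hcircuit, rfl⟩
  exact zsmul_mem hmem n

theorem arnoldIdeal_eq_walkIdeal (h : IsEnds r Γ o s t) :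
    arnoldIdeal r Γ o = walkIdeal r s t Set.univ := by
  apply le_antisymm
  · refine TwoSidedIdeal.span_le.2 ?_
    rintro _ ⟨w, v, ⟨-, hlink, hclosed⟩, rfl⟩
    obtain ⟨L, rfl, hL, hv⟩ := h.exists_isWalk w v hlink
    obtain ⟨n, -, -, harnold⟩ := exists_mon_arnold_eq_smul h L v hv
    rw [hclosed] at hL
    rw [SetLike.mem_coe, harnold]
    exact zsmul_mem hL.dartSum_mem n
  by_cases hloop : ∀ b, s b ≠ t b
  · refine walkIdeal_le fun a L hL => ?_
    obtain ⟨v, hv0, hvlast, hlink, hv⟩ := hL.exists_vertices h hloop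
    exact dartSum_mem_arnoldIdeal h hlink hv (hvlast.trans hv0.symm)
  · push Not at hloop
    obtain ⟨b, hb⟩ := hloop
    have hone : 1 ∈ arnoldIdeal r Γ o := by
      rw [← dartSum_singleton (b, true)]
      refine dartSum_mem_arnoldIdeal h (v := fun _ => s b) ?_ (by simp) rfl
      simpa [← hb] using h.link b
    rw [(TwoSidedIdeal.one_mem_iff _).1 hone]
    exact le_top

end Circuit

section Transport

variable {r : ℕ} {X X' X'' V V' : Type*} {j : X' → X}

/-- The ring homomorphism `e_a ↦ e_{j a}`. -/
def Lam.map (j : X' → X) : Lam r X' →+* Lam r X := Lam.subst fun a => (j a, true)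

@[simp] theorem Lam.map_gen (j : X' → X) (a : X') :
    Lam.map j (Lam.gen r a) = Lam.gen r (j a) := by simp [Lam.map]

theorem Lam.map_map (j : X' → X) (j' : X'' → X') (x : Lam r X'') :
    Lam.map j (Lam.map j' x) = Lam.map (j ∘ j') x := by
  have : (Lam.map j).comp (Lam.map j') = Lam.map (r := r) (j ∘ j') :=
    Lam.hom_ext fun a => by simp
  exact congr($this x)

/-- The left inverse of `Lam.map j`, for `j` injective, that kills the generators outside the
range of `j`. -/
def Lam.pull (j : X' → X) : Lam r X →+* Lam r X' :=
  Lam.lift (Function.extend j (Lam.gen r) 0)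
    (fun a => by unfold Function.extend; split_ifs <;> simp [Lam.gen_mul_self])
    (fun a b => by
      unfold Function.extend
      split_ifs <;> first | exact Lam.gen_mul_gen _ _ | simp)

theorem Lam.pull_map (hj : j.Injective) (x : Lam r X') : Lam.pull j (Lam.map j x) = x := by
  have : (Lam.pull j).comp (Lam.map j) = RingHom.id (Lam r X') :=
    Lam.hom_ext fun a => by simp [Lam.pull, hj.extend_apply]
  exact congr($this x)

theorem Lam.map_pull (hj : j.Injective) (x : Lam r X) :
    Lam.map j (Lam.pull j x) = Lam.ret (Set.range j) x := by
  have : (Lam.map j).comp (Lam.pull j) = Lam.ret (r := r) (Set.range j) :=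
    Lam.hom_ext fun a => by
      by_cases ha : a ∈ Set.range j
      · obtain ⟨b, rfl⟩ := ha
        simp [Lam.pull, hj.extend_apply]
      · simp [Lam.pull, Function.extend_apply' _ _ _ ha, ha]
  exact congr($this x)

theorem Lam.map_mem_supported (hj : j.Injective) (x : Lam r X') :
    Lam.map j x ∈ Lam.supported r (Set.range j) := by
  rw [Lam.mem_supported, ← Lam.map_pull hj, Lam.pull_map hj]

theorem map_mem_walkIdeal {s t : X → V} {s' t' : X' → V'} (p : V' → V)
    {x : Lam r X'} (hx : x ∈ walkIdeal r s' t' Set.univ) (hs : ∀ b, s (j b) = p (s' b))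
    (ht : ∀ b, t (j b) = p (t' b)) : Lam.map j x ∈ walkIdeal r s t (Set.range j) :=
  (TwoSidedIdeal.mem_comap _).1 <| walkIdeal_le_comap (Lam.map j) p
    (fun b _ => ⟨(j b, true), Set.mem_range_self b, by simp, hs b, ht b⟩) hx

theorem pull_mem_walkIdeal (hj : j.Injective) {s t : X → V} {s' t' : X' → V'} (q : V → V')
    {x : Lam r X} (hx : x ∈ walkIdeal r s t (Set.range j)) (hs : ∀ b, s' b = q (s (j b)))
    (ht : ∀ b, t' b = q (t (j b))) : Lam.pull j x ∈ walkIdeal r s' t' Set.univ := by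
  refine (TwoSidedIdeal.mem_comap _).1 <| walkIdeal_le_comap (Lam.pull j) q ?_ hx
  rintro _ ⟨b, rfl⟩
  exact ⟨(b, true), Set.mem_univ b, by simp [Lam.pull, hj.extend_apply], hs b, ht b⟩

end Transport

section DeletionContraction

variable {r : ℕ} {V E : Type*} {Γ : Graph V E} {o : E → V} {s t : E(Γ) → V} {α : E} {a : E(Γ)}

/-- An edge of `Γ / α` as an edge of `Γ`. -/
def ofContrEdge (b : E(contr Γ α)) : E(Γ) := ⟨b, b.2.1⟩

theorem delEdge_injective : (delEdge : E(del Γ α) → E(Γ)).Injective :=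
  fun _ _ h => Subtype.ext (Subtype.mk.inj h)

theorem ofContrEdge_injective : (ofContrEdge : E(contr Γ α) → E(Γ)).Injective :=
  fun _ _ h => Subtype.ext (Subtype.mk.inj h)

theorem range_delEdge : Set.range (delEdge : E(del Γ a) → E(Γ)) = Set.univ \ {a} := by
  ext b
  refine ⟨?_, fun hb => ⟨⟨b, b.2, fun h => hb.2 (Subtype.ext h)⟩, rfl⟩⟩
  rintro ⟨b, rfl⟩
  exact ⟨Set.mem_univ _, fun h => b.2.2 (congrArg Subtype.val h)⟩

theorem contrEdge_surjective : (contrEdge : E(del Γ α) → E(contr Γ α)).Surjective :=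
  fun b => ⟨⟨b, b.2⟩, rfl⟩

theorem range_ofContrEdge : Set.range (ofContrEdge : E(contr Γ a) → E(Γ)) = Set.univ \ {a} := by
  rw [← range_delEdge, ← contrEdge_surjective.range_comp]
  rfl

theorem IsEnds.del (h : IsEnds r Γ o s t) (α : E) :
    IsEnds r (del Γ α) o (s ∘ delEdge) (t ∘ delEdge) where
  link b := by
    simpa [Graph.deleteEdges_isLink] using ⟨h.link (delEdge b), b.2.2⟩
  first hr b := h.first hr (delEdge b)

theorem IsEnds.contr (h : IsEnds r Γ o s t) (α : E) :
    IsEnds r (contr Γ α) (contrOr Γ α o) (Quot.mk _ ∘ s ∘ ofContrEdge)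
      (Quot.mk _ ∘ t ∘ ofContrEdge) where
  link b := by
    exact Graph.IsLink.map _ ((h.del α).link ⟨b, b.2⟩)
  first hr b := congrArg (Quot.mk _) (h.first hr (ofContrEdge b))

theorem quotMk_collapse {x y : V} (hxy : Γ.IsLink α x y) (v : V) :
    Quot.mk (Γ.IsLink α) (collapse x y v) = Quot.mk (Γ.IsLink α) v := by
  by_cases hv : v = x
  · rw [hv, collapse_left]
    exact Quot.sound hxy.symm
  · simp [collapse, hv]

theorem collapse_eq_of_isLink {x y v w : V} (hxy : Γ.IsLink α x y) (hvw : Γ.IsLink α v w) :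
    collapse x y v = collapse x y w := by
  obtain ⟨rfl, rfl⟩ | ⟨rfl, rfl⟩ := hxy.eq_and_eq_or_eq_and_eq hvw <;>
    simp only [collapse_left, collapse_right]

theorem map_delEdge_mem_arnoldIdeal (ho : Odd r → IsOrientation Γ o) {x : Lam r E(del Γ α)}
    (hx : x ∈ arnoldIdeal r (del Γ α) o) : Lam.map delEdge x ∈ arnoldIdeal r Γ o := by
  obtain ⟨s, t, h⟩ := exists_isEnds ho
  rw [arnoldIdeal_eq_walkIdeal (h.del α)] at hx
  rw [arnoldIdeal_eq_walkIdeal h]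
  exact walkIdeal_mono (Set.subset_univ _)
    (map_mem_walkIdeal id hx (fun _ => rfl) fun _ => rfl)

theorem mem_arnoldIdeal_of_map_delEdge_mem [Γ.Loopless] (ho : Odd r → IsOrientation Γ o)
    {x : Lam r E(del Γ α)} (hx : Lam.map delEdge x ∈ arnoldIdeal r Γ o) :
    x ∈ arnoldIdeal r (del Γ α) o := by
  obtain ⟨s, t, h⟩ := exists_isEnds ho
  have hloop : ∀ b ∈ Set.univ, s b ≠ t b := fun b _ => (h.link b).ne
  rw [arnoldIdeal_eq_walkIdeal h] at hx
  rw [arnoldIdeal_eq_walkIdeal (h.del α), ← Lam.pull_map delEdge_injective x]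
  have hmem : Lam.map delEdge x ∈ walkIdeal r s t (Set.range delEdge) :=
    mem_walkIdeal_of_mem_supported (Set.subset_univ _) hloop hx
      (Lam.map_mem_supported delEdge_injective x)
  exact pull_mem_walkIdeal delEdge_injective id hmem (fun _ => rfl) fun _ => rfl

theorem map_contrEdge_mem_arnoldIdeal (ho : Odd r → IsOrientation Γ o) {x : Lam r E(del Γ α)}
    (hx : x ∈ arnoldIdeal r (del Γ α) o) :
    Lam.map contrEdge x ∈ arnoldIdeal r (contr Γ α) (contrOr Γ α o) := by
  obtain ⟨s, t, h⟩ := exists_isEnds ho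
  rw [arnoldIdeal_eq_walkIdeal (h.del α)] at hx
  rw [arnoldIdeal_eq_walkIdeal (h.contr α)]
  exact walkIdeal_mono (Set.subset_univ _)
    (map_mem_walkIdeal (Quot.mk (Γ.IsLink α)) hx (fun _ => rfl) fun _ => rfl)

theorem pull_coeff_mem_arnoldIdeal [Γ.Loopless] (ho : Odd r → IsOrientation Γ o)
    {x : Lam r E(Γ)} (hx : x ∈ arnoldIdeal r Γ o) :
    Lam.pull ofContrEdge (Lam.coeff a x) ∈ arnoldIdeal r (contr Γ a) (contrOr Γ a o) := by
  obtain ⟨s, t, h⟩ := exists_isEnds ho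
  rw [arnoldIdeal_eq_walkIdeal h] at hx
  rw [arnoldIdeal_eq_walkIdeal (h.contr a)]
  have hcoeff : Lam.coeff a x ∈ contrIdeal r s t Set.univ a :=
    coeff_mem_contrIdeal (h.link a).ne hx
  rw [contrIdeal, ← range_ofContrEdge] at hcoeff
  exact pull_mem_walkIdeal ofContrEdge_injective (Quot.mk (Γ.IsLink a)) hcoeff
    (fun _ => (quotMk_collapse (h.link a) _).symm) fun _ => (quotMk_collapse (h.link a) _).symm

theorem exists_sub_map_delEdge_mem_arnoldIdeal (ho : Odd r → IsOrientation Γ o)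
    {x : Lam r E(Γ)}
    (hx : Lam.pull ofContrEdge (Lam.coeff a x) ∈ arnoldIdeal r (contr Γ a) (contrOr Γ a o)) :
    ∃ y : Lam r E(del Γ a), x - Lam.map delEdge y ∈ arnoldIdeal r Γ o := by
  obtain ⟨s, t, h⟩ := exists_isEnds ho
  rw [arnoldIdeal_eq_walkIdeal (h.contr a)] at hx
  rw [arnoldIdeal_eq_walkIdeal h]
  have hcoeff : Lam.coeff a x ∈ contrIdeal r s t Set.univ a := by
    have hmem : Lam.coeff a x ∈ Lam.supported r (Set.univ \ {a}) :=
      Lam.coeff_mem_supported (Lam.mem_supported_univ x)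
    rw [contrIdeal, ← range_ofContrEdge, ← Lam.mem_supported.1 hmem, ← range_ofContrEdge,
      ← Lam.map_pull ofContrEdge_injective]
    exact map_mem_walkIdeal
      (Quot.lift (collapse (s a) (t a)) fun _ _ => collapse_eq_of_isLink (h.link a)) hx
      (fun _ => rfl) fun _ => rfl
  obtain ⟨y, hy, hxy⟩ := exists_sub_mem_walkIdeal (Set.mem_univ a) (Lam.mem_supported_univ x) hcoeff
  rw [← range_delEdge] at hy
  refine ⟨Lam.pull delEdge y, ?_⟩
  rwa [Lam.map_pull delEdge_injective, Lam.mem_supported.1 hy]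

end DeletionContraction

section Quotient

variable {r : ℕ} {V E : Type*} {Γ : Graph V E} {o : E → V}

/-- The quotient map `Λ^r(Γ) → R^r(Γ)`. -/
def toR (r : ℕ) (Γ : Graph V E) (o : E → V) : Lam r E(Γ) →+* R r Γ o :=
  (arnoldIdeal r Γ o).ringCon.mk'

theorem toR_surjective : Function.Surjective (toR r Γ o) := RingCon.mk'_surjective _

theorem toR_gen (b : E(Γ)) : toR r Γ o (Lam.gen r b) = gen r Γ o b := rfl

theorem toR_eq_zero {x : Lam r E(Γ)} : toR r Γ o x = 0 ↔ x ∈ arnoldIdeal r Γ o := by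
  rw [← TwoSidedIdeal.mem_ker, toR, TwoSidedIdeal.ker_ringCon_mk']

theorem toR_eq_toR {x y : Lam r E(Γ)} :
    toR r Γ o x = toR r Γ o y ↔ x - y ∈ arnoldIdeal r Γ o := by
  rw [← toR_eq_zero, map_sub, sub_eq_zero]

end Quotient

section Degree

variable {r : ℕ} {X V E : Type*} {Γ : Graph V E} {o : E → V} {k l : ℤ}

theorem Lam.mon_mem_deg (L : List X) : Lam.mon r L ∈ Lam.deg r X (L.length * ((r : ℤ) - 1)) :=
  AddSubgroup.subset_closure ⟨L, rfl, rfl⟩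

theorem Lam.mul_gen_mem_deg (a : X) {x : Lam r X} (hx : x ∈ Lam.deg r X k) :
    x * Lam.gen r a ∈ Lam.deg r X (k + (r - 1)) := by
  induction hx using AddSubgroup.closure_induction with
  | mem x hx =>
    obtain ⟨L, rfl, rfl⟩ := hx
    have hmon : Lam.mon r L * Lam.gen r a = Lam.mon r (L ++ [a]) := by simp [Lam.mon]
    rw [hmon]
    convert Lam.mon_mem_deg (r := r) (L ++ [a]) using 2
    push_cast [List.length_append, List.length_singleton]
    ring
  | zero => simp
  | add x y _ _ hx hy => rw [add_mul]; exact add_mem hx hy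
  | neg x _ hx => rw [neg_mul]; exact neg_mem hx

theorem Lam.iSup_deg : ⨆ k, Lam.deg r X k = ⊤ := by
  refine eq_top_iff.2 fun x _ => ?_
  have hone : (1 : Lam r X) ∈ ⨆ k, Lam.deg r X k :=
    AddSubgroup.mem_iSup_of_mem _ (Lam.mon_mem_deg [])
  suffices ∀ y ∈ ⨆ k, Lam.deg r X k, y * x ∈ ⨆ k, Lam.deg r X k by simpa using this 1 hone
  clear * -
  induction x using Lam.induction with
  | intCast n =>
    intro y hy
    rw [← zsmul_eq_mul']
    exact zsmul_mem hy n
  | gen a =>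
    intro y hy
    induction hy using AddSubgroup.iSup_induction' with
    | hp k y hy => exact AddSubgroup.mem_iSup_of_mem _ (Lam.mul_gen_mem_deg a hy)
    | h1 => simp
    | hadd y z _ _ hy hz => rw [add_mul]; exact add_mem hy hz
  | add x x' hx hx' =>
    intro y hy
    rw [mul_add]
    exact add_mem (hx y hy) (hx' y hy)
  | mul x x' hx hx' =>
    intro y hy
    rw [← mul_assoc]
    exact hx' _ (hx y hy)

/-- The grading of `Λ^r` as a coaction of the group ring of `ℤ`: an element `x` of degree `k` is
mapped to `x` times the group element `k`. -/
def Lam.grade (r : ℕ) (X : Type*) : Lam r X →+* AddMonoidAlgebra (Lam r X) ℤ :=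
  Lam.lift (fun a => AddMonoidAlgebra.single ((r : ℤ) - 1) (Lam.gen r a))
    (fun a => by rw [AddMonoidAlgebra.single_mul_single, Lam.gen_mul_self]; simp)
    (fun a b => by
      rw [AddMonoidAlgebra.single_mul_single, AddMonoidAlgebra.single_mul_single,
        Lam.gen_mul_gen, AddMonoidAlgebra.smul_single])

theorem Lam.grade_of_mem {x : Lam r X} (hx : x ∈ Lam.deg r X k) :
    Lam.grade r X x = AddMonoidAlgebra.single k x := by
  induction hx using AddSubgroup.closure_induction with
  | mem x hx =>
    obtain ⟨L, rfl, rfl⟩ := hx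
    induction L with
    | nil =>
      rw [List.length_nil, Nat.cast_zero, zero_mul]
      exact map_one _
    | cons a L ih =>
      rw [Lam.mon, List.map_cons, List.prod_cons, ← Lam.mon, map_mul, ih, Lam.grade,
        Lam.lift_gen, AddMonoidAlgebra.single_mul_single]
      congr 1
      push_cast [List.length_cons]
      ring
  | zero => simp
  | add x y _ _ hx hy => rw [map_add, hx, hy, AddMonoidAlgebra.single_add]
  | neg x _ hx => rw [map_neg, hx, AddMonoidAlgebra.single_neg]

theorem arnold_mem_deg (w : List E(Γ)) (v : ℕ → V) :
    arnold r o w v ∈ Lam.deg r E(Γ) (((w.length : ℤ) - 1) * (r - 1)) := by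
  refine sum_mem fun i _ => ?_
  have hmon : Lam.mon r (w.eraseIdx i) ∈ Lam.deg r E(Γ) (((w.length : ℤ) - 1) * (r - 1)) := by
    convert Lam.mon_mem_deg (r := r) (w.eraseIdx i) using 2
    rw [List.length_eraseIdx_of_lt i.2, Nat.cast_pred i.pos]
  obtain hsign | hsign : arnoldSign r o w v i = 1 ∨ arnoldSign r o w v i = -1 := by
    unfold arnoldSign
    split_ifs
    exacts [neg_one_pow_eq_or _ _, .inl rfl, .inr rfl]
  · rwa [hsign, one_mul]
  · rw [hsign, neg_one_mul]
    exact neg_mem hmon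

theorem toR_mem_deg {x : Lam r E(Γ)} (hx : x ∈ Lam.deg r E(Γ) k) : toR r Γ o x ∈ deg r Γ o k :=
  AddSubgroup.mem_map_of_mem _ hx

theorem iSup_deg : ⨆ k, deg r Γ o k = ⊤ := by
  simp only [deg, ← AddSubgroup.map_iSup, Lam.iSup_deg]
  exact AddSubgroup.map_top_of_surjective _ toR_surjective

theorem map_mem_deg {V' E' : Type*} {Γ' : Graph V' E'} {o' : E' → V'} (j : E(Γ) → E(Γ'))
    {f : R r Γ o →+* R r Γ' o'} (hf : ∀ b, f (gen r Γ o b) = gen r Γ' o' (j b)) {x : R r Γ o}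
    (hx : x ∈ deg r Γ o k) : f x ∈ deg r Γ' o' k := by
  obtain ⟨x, hx, rfl⟩ := hx
  induction hx using AddSubgroup.closure_induction with
  | mem x hx =>
    obtain ⟨L, rfl, rfl⟩ := hx
    have hmon : f (toR r Γ o (Lam.mon r L)) = toR r Γ' o' (Lam.mon r (L.map j)) := by
      simp [Lam.mon, map_list_prod, Function.comp_def, toR_gen, hf]
    rw [← L.length_map j]
    exact hmon ▸ toR_mem_deg (Lam.mon_mem_deg _)
  | zero => simp
  | add x y _ _ hx hy => simpa using add_mem hx hy
  | neg x _ hx => simpa using hx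

theorem mul_gen_mem_deg (b : E(Γ)) {x : R r Γ o} (hx : x ∈ deg r Γ o k) :
    x * gen r Γ o b ∈ deg r Γ o (k + (r - 1)) := by
  obtain ⟨x, hx, rfl⟩ := hx
  exact toR_mem_deg (Lam.mul_gen_mem_deg b hx)

/-- The grading of `R^r(Γ)` as a coaction of the group ring of `ℤ`. It exists because the Arnold
classes are homogeneous. -/
def grade (r : ℕ) (Γ : Graph V E) (o : E → V) : R r Γ o →+* AddMonoidAlgebra (R r Γ o) ℤ :=
  RingHom.liftOfSurjective (toR r Γ o) toR_surjective
    ⟨(AddMonoidAlgebra.mapRingHom ℤ (toR r Γ o)).comp (Lam.grade r E(Γ)), fun x hx => by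
      suffices arnoldIdeal r Γ o ≤ TwoSidedIdeal.ker
          ((AddMonoidAlgebra.mapRingHom ℤ (toR r Γ o)).comp (Lam.grade r E(Γ))) from
        (TwoSidedIdeal.mem_ker _).1 (this (toR_eq_zero.1 hx))
      refine TwoSidedIdeal.span_le.2 ?_
      rintro _ ⟨w, v, hwv, rfl⟩
      have harnold : toR r Γ o (arnold r o w v) = 0 :=
        toR_eq_zero.2 (TwoSidedIdeal.subset_span ⟨w, v, hwv, rfl⟩)
      simp [-LaurentPolynomial.single_eq_C_mul_T, TwoSidedIdeal.mem_ker,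
        Lam.grade_of_mem (arnold_mem_deg w v), harnold]⟩

theorem grade_of_mem {x : R r Γ o} (hx : x ∈ deg r Γ o k) :
    grade r Γ o x = AddMonoidAlgebra.single k x := by
  obtain ⟨x, hx, rfl⟩ := hx
  refine (RingHom.liftOfRightInverse_comp_apply ..).trans ?_
  simp [-LaurentPolynomial.single_eq_C_mul_T, Lam.grade_of_mem hx, toR]

/-- The component of degree `k` of an element of `R^r(Γ)`. -/
def component (k : ℤ) : R r Γ o →+ R r Γ o :=
  (Finsupp.applyAddHom k).comp
    ((AddMonoidAlgebra.coeffAddEquiv : _ ≃+ (ℤ →₀ R r Γ o)).toAddMonoidHom.comp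
      (grade r Γ o).toAddMonoidHom)

theorem component_of_mem {x : R r Γ o} (hx : x ∈ deg r Γ o k) : component k x = x := by
  simp [-LaurentPolynomial.single_eq_C_mul_T, component, grade_of_mem hx]

theorem component_of_mem_of_ne {x : R r Γ o} (hx : x ∈ deg r Γ o k) (hkl : k ≠ l) :
    component l x = 0 := by
  simp [-LaurentPolynomial.single_eq_C_mul_T, component, grade_of_mem hx, hkl]

theorem component_mem_deg (k : ℤ) (x : R r Γ o) : component k x ∈ deg r Γ o k := by
  have hx : x ∈ ⨆ l, deg r Γ o l := iSup_deg ▸ AddSubgroup.mem_top x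
  induction hx using AddSubgroup.iSup_induction' with
  | hp l x hx =>
    obtain rfl | hne := eq_or_ne l k
    · rwa [component_of_mem hx]
    · rw [component_of_mem_of_ne hx hne]
      exact zero_mem _
  | h1 => rw [map_zero]; exact zero_mem _
  | hadd x y _ _ hx hy => rw [map_add]; exact add_mem hx hy

theorem component_apply_of_mapsTo_deg {V' E' : Type*} {Γ' : Graph V' E'} {o' : E' → V'}
    {f : R r Γ o →+ R r Γ' o'} {d : ℤ} (hf : ∀ l, ∀ x ∈ deg r Γ o l, f x ∈ deg r Γ' o' (l + d))
    (k : ℤ) (x : R r Γ o) : component (k + d) (f x) = f (component k x) := by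
  have hx : x ∈ ⨆ l, deg r Γ o l := iSup_deg ▸ AddSubgroup.mem_top x
  induction hx using AddSubgroup.iSup_induction' with
  | hp l x hx =>
    obtain rfl | hne := eq_or_ne l k
    · rw [component_of_mem hx, component_of_mem (hf l x hx)]
    · rw [component_of_mem_of_ne hx hne, map_zero,
        component_of_mem_of_ne (hf l x hx) (by simpa using hne)]
  | h1 => simp only [map_zero]
  | hadd x y _ _ hx hy => simp only [map_add, hx, hy]

theorem component_mul_gen (k : ℤ) (x : R r Γ o) (b : E(Γ)) :
    component (k + (r - 1)) (x * gen r Γ o b) = component k x * gen r Γ o b :=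
  component_apply_of_mapsTo_deg (f := AddMonoidHom.mulRight (gen r Γ o b))
    (fun _ _ hx => mul_gen_mem_deg b hx) k x

theorem component_map {V' E' : Type*} {Γ' : Graph V' E'} {o' : E' → V'} (j : E(Γ) → E(Γ'))
    {f : R r Γ o →+* R r Γ' o'} (hf : ∀ b, f (gen r Γ o b) = gen r Γ' o' (j b)) (k : ℤ)
    (x : R r Γ o) : component k (f x) = f (component k x) := by
  have hdeg (l : ℤ) (y) (hy : y ∈ deg r Γ o l) : f.toAddMonoidHom y ∈ deg r Γ' o' (l + 0) :=
    (add_zero l).symm ▸ map_mem_deg j hf hy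
  simpa using component_apply_of_mapsTo_deg hdeg k x

end Degree

section Sequence

variable {r : ℕ} {V E : Type*} {Γ : Graph V E} {o : E → V} {α : E}

/-- The homomorphism `i_α : R^r(Γ ∖ α) → R^r(Γ)`. -/
def delHom (ho : Odd r → IsOrientation Γ o) (α : E) : R r (del Γ α) o →+* R r Γ o :=
  RingHom.liftOfSurjective (toR r (del Γ α) o) toR_surjective
    ⟨(toR r Γ o).comp (Lam.map delEdge), fun _ hx =>
      toR_eq_zero.2 (map_delEdge_mem_arnoldIdeal ho (toR_eq_zero.1 hx))⟩

/-- The homomorphism `q_α : R^r(Γ ∖ α) → R^r(Γ / α)`. -/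
def contrHom (ho : Odd r → IsOrientation Γ o) (α : E) :
    R r (del Γ α) o →+* R r (contr Γ α) (contrOr Γ α o) :=
  RingHom.liftOfSurjective (toR r (del Γ α) o) toR_surjective
    ⟨(toR r (contr Γ α) (contrOr Γ α o)).comp (Lam.map contrEdge), fun _ hx =>
      toR_eq_zero.2 (map_contrEdge_mem_arnoldIdeal ho (toR_eq_zero.1 hx))⟩

/-- The homomorphism `g_α : R^r(Γ) → R^r(Γ / α)`, which reads off the coefficient of `e_α`. -/
def residue [Γ.Loopless] (ho : Odd r → IsOrientation Γ o) (a : E(Γ)) :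
    R r Γ o →+ R r (contr Γ a) (contrOr Γ a o) :=
  AddMonoidHom.liftOfSurjective (toR r Γ o : Lam r E(Γ) →+ R r Γ o) toR_surjective
    ⟨((toR r (contr Γ a) (contrOr Γ a o)).comp (Lam.pull ofContrEdge)).toAddMonoidHom.comp
      (Lam.coeff a), fun _ hx =>
      toR_eq_zero.2 (pull_coeff_mem_arnoldIdeal ho (toR_eq_zero.1 hx))⟩

theorem delHom_toR (ho : Odd r → IsOrientation Γ o) (x : Lam r E(del Γ α)) :
    delHom ho α (toR r (del Γ α) o x) = toR r Γ o (Lam.map delEdge x) :=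
  RingHom.liftOfRightInverse_comp_apply ..

theorem contrHom_toR (ho : Odd r → IsOrientation Γ o) (x : Lam r E(del Γ α)) :
    contrHom ho α (toR r (del Γ α) o x) =
      toR r (contr Γ α) (contrOr Γ α o) (Lam.map contrEdge x) :=
  RingHom.liftOfRightInverse_comp_apply ..

theorem residue_toR [Γ.Loopless] (ho : Odd r → IsOrientation Γ o) (a : E(Γ)) (x : Lam r E(Γ)) :
    residue ho a (toR r Γ o x) =
      toR r (contr Γ a) (contrOr Γ a o) (Lam.pull ofContrEdge (Lam.coeff a x)) :=
  AddMonoidHom.liftOfRightInverse_comp_apply ..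

theorem delHom_gen (ho : Odd r → IsOrientation Γ o) (b : E(del Γ α)) :
    delHom ho α (gen r (del Γ α) o b) = gen r Γ o (delEdge b) := by
  rw [← toR_gen, delHom_toR, Lam.map_gen, toR_gen]

theorem contrHom_gen (ho : Odd r → IsOrientation Γ o) (b : E(del Γ α)) :
    contrHom ho α (gen r (del Γ α) o b) =
      gen r (contr Γ α) (contrOr Γ α o) (contrEdge b) := by
  rw [← toR_gen, contrHom_toR, Lam.map_gen, toR_gen]

theorem Lam.pull_map_delEdge (x : Lam r E(del Γ α)) :
    Lam.pull ofContrEdge (Lam.map (delEdge : _ → E(Γ)) x) = Lam.map contrEdge x := by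
  rw [← Lam.pull_map ofContrEdge_injective (Lam.map contrEdge x), Lam.map_map]
  rfl

variable (ho : Odd r → IsOrientation Γ o) (a : E(Γ))

theorem contrHom_surjective : Function.Surjective (contrHom ho α) := by
  intro z
  obtain ⟨z, rfl⟩ := toR_surjective z
  have hinj : (contrEdge : E(del Γ α) → E(contr Γ α)).Injective :=
    fun _ _ h => Subtype.ext (Subtype.mk.inj h)
  refine ⟨toR r (del Γ α) o (Lam.pull contrEdge z), ?_⟩
  rw [contrHom_toR, Lam.map_pull hinj, contrEdge_surjective.range_eq,
    Lam.mem_supported.1 (Lam.mem_supported_univ z)]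

theorem exists_eq_delHom_add_delHom_mul_gen (x : R r Γ o) :
    ∃ u v : R r (del Γ a) o, x = delHom ho a u + delHom ho a v * gen r Γ o a := by
  obtain ⟨x, rfl⟩ := toR_surjective x
  obtain ⟨u, hu, v, hv, rfl⟩ := Lam.exists_eq_add_mul_gen a (Lam.mem_supported_univ x)
  rw [← range_delEdge, Lam.mem_supported, ← Lam.map_pull delEdge_injective] at hu hv
  refine ⟨toR r _ o (Lam.pull delEdge u), toR r _ o (Lam.pull delEdge v), ?_⟩
  rw [delHom_toR, delHom_toR, hu, hv, map_add, map_mul, toR_gen]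

variable [Γ.Loopless]

theorem residue_delHom_add_delHom_mul_gen (x y : R r (del Γ a) o) :
    residue ho a (delHom ho a x + delHom ho a y * gen r Γ o a) = contrHom ho a y := by
  obtain ⟨x, rfl⟩ := toR_surjective x
  obtain ⟨y, rfl⟩ := toR_surjective y
  have hsupp (z : Lam r E(del Γ (a : E))) : Lam.map delEdge z ∈ Lam.supported r {a}ᶜ := by
    rw [Set.compl_eq_univ_sdiff, ← range_delEdge]
    exact Lam.map_mem_supported delEdge_injective z
  rw [delHom_toR, delHom_toR, ← toR_gen, ← map_mul, ← map_add, residue_toR,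
    Lam.coeff_add_mul_gen (hsupp x) (hsupp y), Lam.pull_map_delEdge, contrHom_toR]

theorem delHom_injective : Function.Injective (delHom ho α) := by
  refine (injective_iff_map_eq_zero _).2 fun x hx => ?_
  obtain ⟨x, rfl⟩ := toR_surjective x
  rw [delHom_toR, toR_eq_zero] at hx
  exact toR_eq_zero.2 (mem_arnoldIdeal_of_map_delEdge_mem ho hx)

theorem residue_eq_zero {x : R r Γ o} : residue ho a x = 0 ↔ ∃ y, delHom ho a y = x := by
  constructor
  · intro hx
    obtain ⟨x, rfl⟩ := toR_surjective x
    rw [residue_toR, toR_eq_zero] at hx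
    obtain ⟨y, hy⟩ := exists_sub_map_delEdge_mem_arnoldIdeal ho hx
    exact ⟨toR r _ o y, by rw [delHom_toR, toR_eq_toR.2 hy]⟩
  · rintro ⟨y, rfl⟩
    simpa using residue_delHom_add_delHom_mul_gen ho a y 0

end Sequence

section GradedSequence

variable {r : ℕ} {V E : Type*} {Γ : Graph V E} {o : E → V} {α : E} {k : ℤ}
  (ho : Odd r → IsOrientation Γ o) (a : E(Γ))

theorem delHom_mem_deg {x : R r (del Γ α) o} (hx : x ∈ deg r (del Γ α) o k) :
    delHom ho α x ∈ deg r Γ o k :=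
  map_mem_deg delEdge (delHom_gen ho) hx

theorem contrHom_mem_deg {x : R r (del Γ α) o} (hx : x ∈ deg r (del Γ α) o k) :
    contrHom ho α x ∈ deg r (contr Γ α) (contrOr Γ α o) k :=
  map_mem_deg contrEdge (contrHom_gen ho) hx

variable [Γ.Loopless]

theorem residue_mem_deg {x : R r Γ o} (hx : x ∈ deg r Γ o k) :
    residue ho a x ∈ deg r (contr Γ a) (contrOr Γ a o) (k - r + 1) := by
  obtain ⟨u, v, huv⟩ := exists_eq_delHom_add_delHom_mul_gen ho a x
  have hk : k = k - r + 1 + (r - 1) := by abel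
  have hx' : x = delHom ho a (component k u) +
      delHom ho a (component (k - r + 1) v) * gen r Γ o a := by
    have hv : component k (delHom ho a v * gen r Γ o a) =
        component (k - r + 1) (delHom ho a v) * gen r Γ o a := by
      rw [← component_mul_gen, ← hk]
    rw [← component_map delEdge (delHom_gen ho), ← component_map delEdge (delHom_gen ho), ← hv,
      ← map_add, ← huv, component_of_mem hx]
  rw [hx', residue_delHom_add_delHom_mul_gen]
  exact contrHom_mem_deg ho (component_mem_deg _ v)

theorem exists_mem_deg_residue_eq {z : R r (contr Γ a) (contrOr Γ a o)}
    (hz : z ∈ deg r (contr Γ a) (contrOr Γ a o) (k - r + 1)) :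
    ∃ x ∈ deg r Γ o k, residue ho a x = z := by
  obtain ⟨v, rfl⟩ := contrHom_surjective ho z
  refine ⟨delHom ho a (component (k - r + 1) v) * gen r Γ o a, ?_, ?_⟩
  · convert mul_gen_mem_deg a (delHom_mem_deg ho (component_mem_deg (k - r + 1) v)) using 2
    abel
  · have := residue_delHom_add_delHom_mul_gen ho a 0 (component (k - r + 1) v)
    rwa [map_zero, zero_add, ← component_map contrEdge (contrHom_gen ho),
      component_of_mem hz] at this

theorem exists_mem_deg_delHom_eq {x : R r Γ o} (hx : x ∈ deg r Γ o k)
    (h : residue ho a x = 0) : ∃ y ∈ deg r (del Γ a) o k, delHom ho a y = x := by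
  obtain ⟨y, rfl⟩ := (residue_eq_zero ho a).1 h
  refine ⟨component k y, component_mem_deg k y, ?_⟩
  rw [← component_map delEdge (delHom_gen ho), component_of_mem hx]

end GradedSequence

end GraphRing

end

theorem corollary1 {V : Type*} {E : Type*} (r : ℕ) (Γ : Graph V E) [Γ.Loopless]
    (o : E → V) (ho : Odd r → GraphRing.IsOrientation Γ o) (α : E) (hα : α ∈ Graph.edgeSet Γ) :
    -- `i` is induced by the inclusion of `Γ ∖ α` in `Γ`, `q` by the map `Γ ∖ α → Γ / α`
    ∃ (i : GraphRing.R r (GraphRing.del Γ α) o →+* GraphRing.R r Γ o)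
      (q : GraphRing.R r (GraphRing.del Γ α) o →+*
        GraphRing.R r (GraphRing.contr Γ α) (GraphRing.contrOr Γ α o))
      (g : GraphRing.R r Γ o →+
        GraphRing.R r (GraphRing.contr Γ α) (GraphRing.contrOr Γ α o)),
      (∀ b, i (GraphRing.gen r (GraphRing.del Γ α) o b) =
        GraphRing.gen r Γ o (GraphRing.delEdge b)) ∧
      (∀ b, q (GraphRing.gen r (GraphRing.del Γ α) o b) =
        GraphRing.gen r (GraphRing.contr Γ α) (GraphRing.contrOr Γ α o)
          (GraphRing.contrEdge b)) ∧
      (∀ x y, g (i x + i y * GraphRing.gen r Γ o ⟨α, hα⟩) = q y) ∧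
      ∀ k : ℤ,
        ∃ (ik : GraphRing.deg r (GraphRing.del Γ α) o k →+ GraphRing.deg r Γ o k)
          (gk : GraphRing.deg r Γ o k →+
            GraphRing.deg r (GraphRing.contr Γ α) (GraphRing.contrOr Γ α o) (k - r + 1)),
          (∀ x, (ik x : GraphRing.R r Γ o) = i x) ∧
          (∀ x, (gk x : GraphRing.R r (GraphRing.contr Γ α) (GraphRing.contrOr Γ α o)) = g x) ∧
          Function.Injective ik ∧ Function.Exact ik gk ∧ Function.Surjective gk := by
  let a : E(Γ) := ⟨α, hα⟩
  let i := GraphRing.delHom ho α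
  let g := GraphRing.residue ho a
  refine ⟨i, GraphRing.contrHom ho α, g, GraphRing.delHom_gen ho, GraphRing.contrHom_gen ho,
    GraphRing.residue_delHom_add_delHom_mul_gen ho a, fun k => ?_⟩
  refine ⟨(i.toAddMonoidHom.domRestrict _).codRestrict _ fun x => GraphRing.delHom_mem_deg ho x.2,
    (g.domRestrict _).codRestrict _ fun x => GraphRing.residue_mem_deg ho a x.2,
    fun _ => rfl, fun _ => rfl, ?_, ?_, ?_⟩
  · exact fun x y hxy => Subtype.ext (GraphRing.delHom_injective ho (congrArg Subtype.val hxy))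
  · refine fun x => ⟨fun hx => ?_, ?_⟩
    · obtain ⟨y, hy, hyx⟩ :=
        GraphRing.exists_mem_deg_delHom_eq ho a x.2 (congrArg Subtype.val hx)
      exact ⟨⟨y, hy⟩, Subtype.ext hyx⟩
    · rintro ⟨y, rfl⟩
      exact Subtype.ext ((GraphRing.residue_eq_zero ho a).2 ⟨y, rfl⟩)
  · intro z
    obtain ⟨x, hx, hxz⟩ := GraphRing.exists_mem_deg_residue_eq ho a z.2
    exact ⟨⟨x, hx⟩, Subtype.ext hxz⟩
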